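/- Homology is simplicial homology with coefficients in $\mathbb Z/2\mathbb Z$, and $\tilde H_r$ denotes reduced homology in degree $r\ge 0$ (zero for the empty complex). For a cover filtration $\mathcal U=\{U_i\}_{i\in I}$ (finitely many filtrations $U_i=(U_i^\alpha)_{\alpha\ge 0}$ by subcomplexes of one finite complex) put $U_\sigma^\alpha=\bigcap_{i\in\sigma}U_i^\alpha$ for $\emptyset\ne\sigma\subseteq I$, let $\mathcal W$ be the union filtration $W^\alpha=\bigcup_i U_i^\alpha$, and let $\mathrm{Nrv}\,\mathcal U$ be the nerve filtration, whose simplices at scale $\alpha$ are the non-empty $\sigma\subseteq I$ with $U_\sigma^\alpha\ne\emptyset$. $\mathcal U$ is $\varepsilon$-good if $\tilde H_r(U_\sigma^\alpha\hookrightarrow U_\sigma^{\alpha+\varepsilon})=0$ for all non-empty $\sigma$, all $\alpha\ge0$ and all $r\ge 0$. $\mathrm{Dgm}_r$ is the persistence diagram of (unreduced) $r$-dimensional homology, which contains the diagonal with infinite multiplicity and may contain points $(x,\infty)$, and $d_B$ is the bottleneck distance. Let $n\ge 0$. Cover the boundary of the standard $(n+1)$-simplex on the vertices $\{0,\dots,n+1\}$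 by its facets $t_i$ (spanned by all vertices except $i$), which grow over time as follows: for $0\le i\le n+1$, $$U_i^\alpha=\begin{cases} t_i & 0\le\alpha<n+1,\\ t_i\cup\bigcup_{k=0}^{\lfloor\alpha\rfloor-n-1}t_k & n+1\le\alpha<2n+2,\\ \text{the full }(n+1)\text{-simplex} & \alpha\ge 2n+2.\end{cases}$$ Then $\mathcal U=\{U_0,\dots,U_{n+1}\}$ has the following properties. 1. $\tilde H_r(W^\alpha)$ has rank $1$ if $r=n$ and $\alpha<2n+2$, and rank $0$ otherwise; $\tilde H_r(\mathrm{Nrv}\,\mathcal U^\alpha)$ has rank $1$ if $r=n$ and $\alpha<n+1$, and rank $0$ otherwise. 2. Off the diagonal, $\mathrm{Dgm}_n(\mathcal W)$ contains the point $(0,2n+2)$ and $\mathrm{Dgm}_n(\mathrm{Nrv}\,\mathcal U)$ contains the point $(0,n+1)$, each with multiplicity one. Apart from these, the only off-diagonal point of the diagrams of $\mathcal W$ and of $\mathrm{Nrv}\,\mathcal U$, over all dimensions, is the point $(0,\infty)$ of multiplicity one in dimension $0$. 3. $d_B(\mathrm{Dgm}_n(\mathrm{Nrv}\,\mathcal U),\mathrm{Dgm}_n(\mathcal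 W))=n+1$. 4. Let $0\le j\le n$ and write $(j,n+1]=\{j+1,\dots,n+1\}$ and $[j]=\{0,\dots,j\}$. (a) If $\sigma\ne\emptyset$, $m>j$ and $m\notin\sigma$, then the geometric realization of $U_\sigma^{n+1+j}$ deformation retracts (strongly) to the vertex $m$, and $\tilde H_*(U_\sigma^{n+1+j})=0$. (b) If $p\le j$ and $\sigma=(j,n+1]\cup\{p\}$, then $\tilde H_*(U_\sigma^{n+1+j})=0$. (c) If $\sigma\supseteq(j,n+1]$ and $\#(\sigma\cap[j])\ge2$, then $\tilde H_*(U_\sigma^{n+1+j})=0$. (d) Hence, for $\sigma\neq\emptyset$, $U_\sigma^{n+1+j}$ has non-trivial reduced homology only if $\sigma=(j,n+1]$. 5. $\mathcal U$ is a $1$-good cover filtration of $\mathcal W$. Moreover the bound $(K+1)\varepsilon$ is attained in all dimensions at once: for all $N\ge0$ and $\varepsilon>0$, the disjoint union $\mathcal U'$ over $n=0,\dots,N$ of the above cover filtrations with rescaled index ($U_i^{\alpha/\varepsilon}$ at scale $\alpha$) is an $\varepsilon$-good cover filtration of its union filtration $\mathcal W'$, and $d_B(\mathrm{Dgm}_K(\mathrm{Nrv}\,\mathcal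 U'),\mathrm{Dgm}_K(\mathcal W'))=(K+1)\varepsilon$ for every $0\le K\le N$. -/

import Mathlib

open scoped NNReal ENNReal

noncomputable section

/-! ### Simplicial homology over `ℤ/2ℤ`

An abstract simplicial complex with vertices in `V` is Mathlib's `PreAbstractSimplicialComplex V`:
a set of non-empty finite subsets of `V`, closed under taking non-empty subsets.  It may be empty,
and not every element of `V` has to be a vertex of it. -/

/-- The full simplex spanned by the vertices in `A`. -/
def fullSimplex {V : Type*} (A : Set V) : PreAbstractSimplicialComplex V where
  faces := {σ | σ.Nonempty ∧ (σ : Set V) ⊆ A}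
  isRelLowerSet_faces := fun _ hσ =>
    ⟨hσ.1, fun _ hτσ hτ => ⟨hτ, (Finset.coe_subset.mpr hτσ).trans hσ.2⟩⟩

/-- The geometric realization: the union of the convex hulls of the images of the simplices under
`v ↦ e_v`, as a subspace of `ℝ^V`. -/
def geometricRealization {V : Type*} [DecidableEq V] (K : PreAbstractSimplicialComplex V) :
    Set (V → ℝ) :=
  ⋃ σ ∈ K, convexHull ℝ ((fun v : V => (Pi.single v 1 : V → ℝ)) '' (σ : Set V))

/-- The chain group `C_k(K)`: formal sums of the `k`-simplices of `K`, written as functions on the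
finite subsets of the (finite) set `V` that vanish off the `k`-simplices of `K`. -/
def simplicialChains {V : Type*} (K : PreAbstractSimplicialComplex V)
    (k : ℕ) : Submodule (ZMod 2) (Finset V → ZMod 2) where
  carrier := {c | ∀ σ, ¬ (σ ∈ K ∧ σ.card = k + 1) → c σ = 0}
  zero_mem' _ _ := rfl
  add_mem' hc hd σ hσ := by simp [hc σ hσ, hd σ hσ]
  smul_mem' a c hc σ hσ := by simp [hc σ hσ]

/-- The augmented boundary map: a finite set `σ` is sent to the formal sum of the sets `σ \ {v}` for
`v ∈ σ`. In particular a vertex `{v}` is sent to the generator `∅` of degree `-1`. -/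
def simplicialBoundary (V : Type*) [Fintype V] [DecidableEq V] :
    (Finset V → ZMod 2) →ₗ[ZMod 2] (Finset V → ZMod 2) :=
  Fintype.linearCombination (ZMod 2)
    (fun σ : Finset V => ∑ v ∈ σ, (Pi.single (σ.erase v) 1 : Finset V → ZMod 2))

/-- The kernel of `∂_k` on `C_k(K)` for the augmented chain complex. -/
def reducedCycles {V : Type*} [Fintype V] [DecidableEq V] (K : PreAbstractSimplicialComplex V)
    (k : ℕ) : Submodule (ZMod 2) (Finset V → ZMod 2) :=
  simplicialChains K k ⊓ LinearMap.ker (simplicialBoundary V)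

/-- The kernel of `∂_k` on `C_k(K)` for the ordinary chain complex, where `C_{-1}(K) = 0`, so that
`∂_0 = 0`. -/
def simplicialCycles {V : Type*} [Fintype V] [DecidableEq V] (K : PreAbstractSimplicialComplex V)
    (k : ℕ) : Submodule (ZMod 2) (Finset V → ZMod 2) :=
  if k = 0 then simplicialChains K 0 else reducedCycles K k

/-- The image of `∂_{k+1}` on `C_{k+1}(K)`. -/
def simplicialBoundaries {V : Type*} [Fintype V] [DecidableEq V] (K : PreAbstractSimplicialComplex V)
    (k : ℕ) : Submodule (ZMod 2) (Finset V → ZMod 2) :=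
  (simplicialChains K (k + 1)).map (simplicialBoundary V)

/-- The reduced homology group in degree `k ≥ 0`. -/
abbrev ReducedHomology {V : Type*} [Fintype V] [DecidableEq V] (K : PreAbstractSimplicialComplex V)
    (k : ℕ) : Type _ :=
  reducedCycles K k ⧸ (simplicialBoundaries K k).submoduleOf (reducedCycles K k)

/-- The homology group `H_k(K) = ker ∂_k / im ∂_{k+1}`. -/
abbrev SimplicialHomology {V : Type*} [Fintype V] [DecidableEq V] (K : PreAbstractSimplicialComplex V)
    (k : ℕ) : Type _ :=
  simplicialCycles K k ⧸ (simplicialBoundaries K k).submoduleOf (simplicialCycles K k)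

theorem simplicialChains_mono {V : Type*} {K L : PreAbstractSimplicialComplex V} (h : K ≤ L)
    (k : ℕ) : simplicialChains K k ≤ simplicialChains L k :=
  fun _ hc σ hσ => hc σ fun hσ' => hσ ⟨h hσ'.1, hσ'.2⟩

theorem reducedCycles_mono {V : Type*} [Fintype V] [DecidableEq V]
    {K L : PreAbstractSimplicialComplex V}
    (h : K ≤ L) (k : ℕ) : reducedCycles K k ≤ reducedCycles L k :=
  inf_le_inf_right _ (simplicialChains_mono h k)

theorem simplicialCycles_mono {V : Type*} [Fintype V] [DecidableEq V]
    {K L : PreAbstractSimplicialComplex V}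
    (h : K ≤ L) (k : ℕ) : simplicialCycles K k ≤ simplicialCycles L k := by
  unfold simplicialCycles
  split_ifs
  · exact simplicialChains_mono h 0
  · exact reducedCycles_mono h k

theorem simplicialBoundaries_mono {V : Type*} [Fintype V] [DecidableEq V]
    {K L : PreAbstractSimplicialComplex V} (h : K ≤ L) (k : ℕ) :
    simplicialBoundaries K k ≤ simplicialBoundaries L k :=
  Submodule.map_mono (simplicialChains_mono h (k + 1))

/-- The map induced on reduced homology in degree `k` by the inclusion `K ↪ L`. -/
def reducedHomologyMap {V : Type*} [Fintype V] [DecidableEq V]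
    {K L : PreAbstractSimplicialComplex V}
    (h : K ≤ L) (k : ℕ) : ReducedHomology K k →ₗ[ZMod 2] ReducedHomology L k :=
  Submodule.mapQ _ _ (Submodule.inclusion (reducedCycles_mono h k))
    fun _ hx => simplicialBoundaries_mono h k hx

/-- The map induced on homology in degree `k` by the inclusion `K ↪ L`. -/
def simplicialHomologyMap {V : Type*} [Fintype V] [DecidableEq V]
    {K L : PreAbstractSimplicialComplex V}
    (h : K ≤ L) (k : ℕ) : SimplicialHomology K k →ₗ[ZMod 2] SimplicialHomology L k :=
  Submodule.mapQ _ _ (Submodule.inclusion (simplicialCycles_mono h k))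
    fun _ hx => simplicialBoundaries_mono h k hx

/-! ### Filtrations, persistence modules and persistence diagrams -/

/-- A simplicial filtration `(F^α)_{α ≥ 0}` of subcomplexes of the full simplex on `V`. -/
abbrev SimplicialFiltration (V : Type*) := ℝ≥0 →o PreAbstractSimplicialComplex V

/-- A persistence module indexed by `α ≥ 0`. -/
abbrev PersistenceModule : Type _ := CategoryTheory.Functor ℝ≥0 (ModuleCat.{0} (ZMod 2))

/-- The persistence module `H_k(F)`: the homology groups `H_k(F^α)` with the maps induced by the
inclusions `F^α ↪ F^β`, for `α ≤ β`. -/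
def persistentHomology {V : Type} [Fintype V] [DecidableEq V] (F : SimplicialFiltration V) (k : ℕ) :
    PersistenceModule where
  obj α := ModuleCat.of (ZMod 2) (SimplicialHomology (F α) k)
  map f := ModuleCat.ofHom (simplicialHomologyMap (F.monotone f.le) k)
  map_id α := by
    ext x
    rfl
  map_comp f g := by
    ext x
    rfl

/-- The rank `r(s, t)` of the structure map from `s` to `t`, for real numbers `s ≤ t`; the module is
extended by zero to negative indices. -/
def PersistenceModule.rank (M : PersistenceModule) (s t : ℝ) : ℕ :=
  if h : 0 ≤ s ∧ s ≤ t then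
    Module.finrank (ZMod 2)
      (LinearMap.range (M.map (CategoryTheory.homOfLE (Real.toNNReal_le_toNNReal h.2))).hom)
  else 0

/-- The rank `r(s, t)` where `t` may be infinite; the module is zero at `±∞`. -/
def PersistenceModule.rankExt (M : PersistenceModule) (s : ℝ) (t : EReal) : ℕ :=
  if t = ⊤ ∨ t = ⊥ then 0 else M.rank s t.toReal

/-- The persistence measure of the rectangle `[a, b] × [c, d]`, where `a < b ≤ c < d ≤ ∞`:
`r(b, c) - r(a, c) - r(b, d) + r(a, d)`, the number of features that are born between `a` and `b`
and die between `c` and `d`.  It is non-negative for a pointwise finite-dimensional module, so that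
the subtraction of natural numbers is a true one. -/
def PersistenceModule.measure (M : PersistenceModule) (a b c : ℝ) (d : EReal) : ℕ :=
  M.rank b c + M.rankExt a d - (M.rank a c + M.rankExt b d)

/-- The multiplicity of a point `p = (x, y)` with `x < y ≤ ∞` in the persistence diagram of a
pointwise finite-dimensional module: the least measure of a rectangle `[a, b] × [c, d]` above the
diagonal that is a neighbourhood of `p` in the extended plane. -/
def PersistenceModule.multiplicity (M : PersistenceModule) (p : ℝ × EReal) : ℕ :=
  sInf {m | ∃ (a b c : ℝ) (d : EReal), a < p.1 ∧ p.1 < b ∧ b ≤ c ∧ (c : EReal) < p.2 ∧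
    (p.2 < d ∨ (p.2 = ⊤ ∧ d = ⊤)) ∧ m = M.measure a b c d}

/-- A multiset of points in the extended plane, given by the multiplicities of the points. -/
abbrev PersistenceDiagram : Type := ℝ × EReal → ℕ∞

/-- The persistence diagram of a persistence module. Every diagonal point `(x, x)` has infinite
multiplicity. -/
def PersistenceModule.diagram (M : PersistenceModule) : PersistenceDiagram := fun p =>
  if (p.1 : EReal) < p.2 then (M.multiplicity p : ℕ∞) else if (p.1 : EReal) = p.2 then ⊤ else 0

/-- `Dgm_k(F)`, the persistence diagram of the filtration `F` in dimension `k`. -/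
def Dgm {V : Type} [Fintype V] [DecidableEq V] (k : ℕ) (F : SimplicialFiltration V) : PersistenceDiagram :=
  (persistentHomology F k).diagram

/-- The elements of a persistence diagram, counted with multiplicity. -/
abbrev PersistenceDiagram.Elements (D : PersistenceDiagram) : Type :=
  Σ p : ℝ × EReal, {i : ℕ // (i : ℕ∞) < D p}

/-- The distance of two extended real numbers, where `|∞ - ∞| = 0`. -/
def extendedDist (x y : EReal) : ℝ≥0∞ := if x = y then 0 else (x - y).abs

/-- The `ℓ^∞`-distance in the extended plane. -/
def planeDist (p q : ℝ × EReal) : ℝ≥0∞ := max (extendedDist p.1 q.1) (extendedDist p.2 q.2)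

/-- The bottleneck distance. -/
def bottleneckDist (D D' : PersistenceDiagram) : ℝ≥0∞ :=
  ⨅ φ : D.Elements ≃ D'.Elements, ⨆ x : D.Elements, planeDist x.1 (φ x).1

/-! ### Cover filtrations -/

/-- A family `U = (U_i)` of simplicial filtrations. -/
abbrev CoverFiltration (ι V : Type*) := ι → SimplicialFiltration V

namespace CoverFiltration

/-- The union filtration `W^α = ⋃_i U_i^α`. -/
def union {ι V : Type*} (U : CoverFiltration ι V) : SimplicialFiltration V where
  toFun α := ⨆ i, U i α
  monotone' _ _ h := iSup_mono fun i => (U i).monotone h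

/-- The filtration `U_v^α = ⋂_{i ∈ v} U_i^α`, for a non-empty `v`. -/
def inter {ι V : Type*} (U : CoverFiltration ι V) (v : Finset ι) : SimplicialFiltration V where
  toFun α := ⨅ i ∈ v, U i α
  monotone' _ _ h := iInf₂_mono fun i _ => (U i).monotone h

/-- The nerve filtration: `v` is a simplex of `Nrv(U^α)` if `U_v^α` is not empty. -/
def nerve {ι V : Type*} (U : CoverFiltration ι V) : SimplicialFiltration ι where
  toFun α :=
    { faces := {v | v.Nonempty ∧ (U.inter v α).faces.Nonempty}
      isRelLowerSet_faces := fun _ hv => ⟨hv.1, fun _ hwv hw =>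
        ⟨hw, hv.2.mono (show U.inter _ α ≤ U.inter _ α from biInf_mono fun _ hi => hwv hi)⟩⟩ }
  monotone' _ _ h _ hv := ⟨hv.1, hv.2.mono ((U.inter _).monotone h)⟩

/-- `U` is an `ε`-good cover filtration of its union filtration: for all non-empty `v` and all
`α ≥ 0`, the inclusion of `U_v^α` in `U_v^{α+ε}` is zero on reduced homology in all degrees
`k ≥ 0`. -/
def IsGood {ι V : Type*} [Fintype V] [DecidableEq V] (ε : ℝ≥0) (U : CoverFiltration ι V) : Prop :=
  ∀ v : Finset ι, v.Nonempty → ∀ (α : ℝ≥0) (k : ℕ),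
    reducedHomologyMap ((U.inter v).monotone (le_self_add : α ≤ α + ε)) k = 0

/-- The rescaled cover filtration, with `U_i^{α/ε}` at the scale `α`. -/
def rescale {ι V : Type*} (ε : ℝ≥0) (U : CoverFiltration ι V) : CoverFiltration ι V := fun i =>
  { toFun := fun α => U i (α / ε)
    monotone' := fun _ _ h => (U i).monotone (by gcongr) }

/-- The disjoint union of cover filtrations: the vertex set is the disjoint union of the vertex
sets, and there is one cover element for each element of each of the covers. -/
def disjointUnion {J : Type*} {ι V : J → Type*} [DecidableEq (Σ j, V j)]
    (U : ∀ j, CoverFiltration (ι j) (V j)) : CoverFiltration (Σ j, ι j) (Σ j, V j) := fun x =>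
  { toFun := fun α => (U x.1 x.2 α).map (Sigma.mk x.1)
    monotone' := fun _ _ h => Set.image_mono ((U x.1 x.2).monotone h) }

end CoverFiltration

/-! ### The example -/

/-- The facet `t_i` of the standard `(n+1)`-simplex with the vertices `0, …, n+1`: the full simplex
on all vertices but `i`. -/
def simplexFacet (n : ℕ) (i : Fin (n + 2)) : PreAbstractSimplicialComplex (Fin (n + 2)) :=
  fullSimplex {i}ᶜ

/-- The complex `U_i^α`: `t_i` for `0 ≤ α < n+1`, the union of `t_i` and the `t_k` with
`0 ≤ k ≤ ⌊α⌋ - (n+1)` for `n+1 ≤ α < 2n+2`, and the full `(n+1)`-simplex for `2n+2 ≤ α`. -/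
def growingFacetComplex (n : ℕ) (i : Fin (n + 2)) (α : ℝ≥0) :
    PreAbstractSimplicialComplex (Fin (n + 2)) :=
  if α < n + 1 then simplexFacet n i
  else if α < 2 * n + 2 then
    simplexFacet n i ⊔ ⨆ k : {k : Fin (n + 2) // (k : ℕ) + (n + 1) ≤ ⌊α⌋₊}, simplexFacet n k
  else fullSimplex Set.univ

theorem growingFacetComplex_monotone (n : ℕ) (i : Fin (n + 2)) :
    Monotone (growingFacetComplex n i) := by
  have top_le : ∀ K : PreAbstractSimplicialComplex (Fin (n + 2)), K ≤ fullSimplex Set.univ :=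
    fun K σ hσ => ⟨(K.isRelLowerSet_faces hσ).1, Set.subset_univ _⟩
  intro α β h
  unfold growingFacetComplex
  by_cases h3 : β < 2 * n + 2
  · have h2 : α < 2 * n + 2 := lt_of_le_of_lt h h3
    by_cases h4 : β < n + 1
    · have h1 : α < n + 1 := lt_of_le_of_lt h h4
      rw [if_pos h1, if_pos h4]
    · rw [if_neg h4, if_pos h3]
      by_cases h1 : α < n + 1
      · rw [if_pos h1]
        exact le_sup_left
      · rw [if_neg h1, if_pos h2]
        refine sup_le_sup_left (iSup_le fun k => ?_) _
        exact le_iSup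
          (fun k : {k : Fin (n + 2) // (k : ℕ) + (n + 1) ≤ ⌊β⌋₊} => simplexFacet n k)
          ⟨k.1, k.2.trans (Nat.floor_le_floor h)⟩
  · have h4 : ¬ β < n + 1 := fun h4 => h3 (h4.trans_le (by
      have : (n : ℝ≥0) + 1 ≤ 2 * (n + 1) := le_mul_of_one_le_left (by positivity) (by norm_num)
      linarith))
    rw [if_neg h4, if_neg h3]
    exact top_le _

/-- The cover filtration `U = {U_0, …, U_{n+1}}` by the growing facets. -/
def facetCover (n : ℕ) : CoverFiltration (Fin (n + 2)) (Fin (n + 2)) := fun i =>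
  { toFun := growingFacetComplex n i
    monotone' := growingFacetComplex_monotone n i }

/-- The disjoint union, over the dimensions `n = 0, …, N`, of the cover filtrations by growing
facets with the scales multiplied by `ε`. -/
def facetCoverUnion (N : ℕ) (ε : ℝ≥0) :
    CoverFiltration (Σ n : Fin (N + 1), Fin ((n : ℕ) + 2)) (Σ n : Fin (N + 1), Fin ((n : ℕ) + 2)) :=
  CoverFiltration.disjointUnion fun n : Fin (N + 1) => (facetCover n).rescale ε

end

/-!
The proof identifies the filtrations whose diagrams are compared, and computes with those instead
of with the growing facets.  A face lies in the union of the cover at scale `α` exactly if it is not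
the full simplex or `2 * n + 2 ≤ α`, and in the nerve exactly if it is not the full simplex or
`n + 1 ≤ α` (`mem_union_facetCover`, `mem_nerve_facetCover`).  So both are the boundary of a simplex
that is filled in at a certain scale, and for the disjoint union of the covers one obtains disjoint
unions of such spheres.  These are the filtrations `sphereFiltration π T`: the vertices are divided
into the fibres of `π`, and the sphere over `j` is filled in at the scale `T j`.

The homology of a disjoint union of spheres is detected by linear functionals: the coefficient at
one facet of each `r`-dimensional sphere that is not filled in, and in degree `0` also the sum of
the coefficients over each fibre.  A cycle on which they vanish is the sum of its restrictions to
the fibres, each of which bounds the cone on it with an apex in the fibre; the functionals are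
independent on cycles because of the fundamental cycles and the vertices.  This gives the ranks of
all structure maps (`finrank_range_simplicialHomologyMap_sphereUnion`), and thereby the persistence
diagrams (`Dgm_sphereFiltration`): everything is born at `0`, one class for each sphere dies at
`T j`, and one class for each component lives forever.  If one death time is doubled from `t` to
`2 * t`, then the bottleneck distance is `t`, since moving the point costs `t`, and `(0, 2 * t)` is
at distance `t` from the diagonal (`bottleneckDist_sphereFiltration`).

For the goodness of the cover, a face `τ` belongs to the intersection over `σ` at scale `α` exactly
if it is disjoint from `σ`, or misses a vertex `k ≤ ⌊α⌋ - (n + 1)`, or `2 * n + 2 ≤ α`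
(`mem_inter_facetCover`).  A vertex `m ∉ σ` with `m > ⌊α⌋ - (n + 1)` is the apex of a cone, and if
`σ` contains some `p ≤ ⌊α⌋ - (n + 1)`, then the first condition implies the second one and the last
vertex is an apex.  For non-empty intersections, this and the trivial case `2 * n + 2 ≤ α` leave
only `n + 1 ≤ α < 2 * n + 2` and `σ = {m | m > ⌊α⌋ - (n + 1)}`, which does not persist to the scale
`α + 1` (`isCone_inter_facetCover_or_add_one`).
-/

noncomputable section

/-! ### Boundaries, cones and restrictions of chains -/

section Chains

/-- A complex is a (possibly empty) cone if some vertex can be added to each of its simplices. -/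
def IsCone {V : Type*} [DecidableEq V] (K : PreAbstractSimplicialComplex V) : Prop :=
  ∃ m, ∀ τ ∈ K, insert m τ ∈ K

theorem mem_simplicialChains {V : Type*} {K : PreAbstractSimplicialComplex V} {k : ℕ}
    {c : Finset V → ZMod 2} :
    c ∈ simplicialChains K k ↔ ∀ σ, c σ ≠ 0 → σ ∈ K ∧ σ.card = k + 1 :=
  forall_congr' fun _ => not_imp_comm

variable {V : Type*} [Fintype V] [DecidableEq V]

theorem simplicialBoundary_apply (c : Finset V → ZMod 2) (τ : Finset V) :
    simplicialBoundary V c τ = ∑ v, if v ∈ τ then 0 else c (insert v τ) := by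
  have key : ∀ σ : Finset V, ∀ v : V,
      (if v ∈ σ then c σ * (Pi.single (σ.erase v) 1 : Finset V → ZMod 2) τ else 0) =
        if σ = insert v τ then (if v ∈ τ then 0 else c σ) else 0 := by
    intro σ v
    by_cases hv : v ∈ σ
    · by_cases hvτ : v ∈ τ
      · have : τ ≠ σ.erase v := fun h => by simp [h] at hvτ
        simp [hv, hvτ, this]
      · by_cases h : σ = insert v τ
        · have : τ = σ.erase v := by simp [h, hvτ]
          simp [← h, hv, hvτ, ← this]
        · have : τ ≠ σ.erase v := fun h' => h (by rw [h', Finset.insert_erase hv])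
          simp [hv, this, h]
    · have : σ ≠ insert v τ := fun h => hv (by simp [h])
      simp [hv, this]
  calc simplicialBoundary V c τ
      = ∑ σ, ∑ v, if v ∈ σ then c σ * (Pi.single (σ.erase v) 1 : Finset V → ZMod 2) τ else 0 := by
        simp only [simplicialBoundary, Fintype.linearCombination_apply, Finset.sum_apply,
          Pi.smul_apply, smul_eq_mul, Finset.mul_sum]
        refine Finset.sum_congr rfl fun σ _ => ?_
        rw [← Finset.sum_filter]
        simp
    _ = _ := by
        simp only [key]
        rw [Finset.sum_comm]
        exact Finset.sum_congr rfl fun v _ => by simp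

theorem simplicialBoundary_single (σ : Finset V) :
    simplicialBoundary V (Pi.single σ 1) = ∑ v ∈ σ, Pi.single (σ.erase v) 1 := by
  simp [simplicialBoundary, Fintype.linearCombination_apply_single]

theorem simplicialBoundary_simplicialBoundary (c : Finset V → ZMod 2) :
    simplicialBoundary V (simplicialBoundary V c) = 0 := by
  ext τ
  simp only [simplicialBoundary_apply, Pi.zero_apply]
  have : ∀ v, (if v ∈ τ then 0 else
        ∑ u, if u ∈ insert v τ then 0 else c (insert u (insert v τ))) =
      ∑ u, if v ∈ τ ∨ u ∈ insert v τ then 0 else c (insert u (insert v τ)) := by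
    intro v
    by_cases hv : v ∈ τ <;> simp [hv]
  simp only [this, ← Finset.sum_product']
  -- every face of codimension two is reached in two ways, which cancel modulo two
  refine Finset.sum_involution (fun p _ => p.swap) ?_ ?_ (by simp) (by simp)
  · rintro ⟨v, u⟩ -
    have h1 : (u ∈ τ ∨ v ∈ insert u τ) ↔ (v ∈ τ ∨ u ∈ insert v τ) := by grind
    simp only [Prod.swap, h1, Finset.insert_comm v u]
    exact CharTwo.add_self_eq_zero _
  · rintro ⟨v, u⟩ - h h'
    have : u = v := congrArg Prod.fst h'
    simp [this] at h

/-- The cone with apex `m` on a chain: a simplex `σ` is sent to `σ ∪ {m}` if `m ∉ σ`, and to `0`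
otherwise. -/
def coneChain (m : V) (c : Finset V → ZMod 2) : Finset V → ZMod 2 :=
  fun τ => if m ∈ τ then c (τ.erase m) else 0

/-- The cone is a contracting homotopy of the augmented chain complex of the full simplex. -/
theorem simplicialBoundary_coneChain (m : V) {c : Finset V → ZMod 2}
    (hc : simplicialBoundary V c = 0) : simplicialBoundary V (coneChain m c) = c := by
  ext τ
  rw [simplicialBoundary_apply]
  by_cases hm : m ∈ τ
  · have h0 := congrFun hc (τ.erase m)
    rw [simplicialBoundary_apply, Fintype.sum_eq_add_sum_compl m] at h0
    rw [Fintype.sum_eq_add_sum_compl m]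
    simp only [Finset.mem_erase, ne_eq, not_true_eq_false, false_and, if_false,
      Finset.insert_erase hm, Pi.zero_apply] at h0
    have : ∀ v ∈ ({m} : Finset V)ᶜ, (if v ∈ τ then 0 else coneChain m c (insert v τ)) =
        if ¬ v = m ∧ v ∈ τ then 0 else c (insert v (τ.erase m)) := by
      intro v hv
      have hv : v ≠ m := by simpa using hv
      simp [coneChain, hv, hm, Finset.erase_insert_of_ne hv]
    rw [Finset.sum_congr rfl this, if_pos hm, zero_add]
    exact (CharTwo.add_eq_zero.mp h0).symm
  · rw [Fintype.sum_eq_single m]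
    · simp [hm, coneChain]
    · intro v hv
      simp [coneChain, hm, hv.symm]

/-- The part of a chain that is supported on the subsets of `A`. -/
def restrictChain (A : Finset V) (c : Finset V → ZMod 2) : Finset V → ZMod 2 :=
  fun τ => if τ ⊆ A then c τ else 0

/-- Restriction to `A` commutes with the boundary in degrees at least `0` if no simplex of the
chain meets both `A` and its complement.  In degree `-1` this fails, since `∅ ⊆ A`. -/
theorem simplicialBoundary_restrictChain {A : Finset V} {c : Finset V → ZMod 2}
    (hc : ∀ σ, c σ ≠ 0 → σ ⊆ A ∨ Disjoint σ A) {τ : Finset V} (hτ : τ.Nonempty) :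
    simplicialBoundary V (restrictChain A c) τ = restrictChain A (simplicialBoundary V c) τ := by
  simp only [restrictChain, simplicialBoundary_apply]
  split_ifs with h
  · refine Finset.sum_congr rfl fun v _ => ?_
    split_ifs with h1 h2
    · rfl
    · rfl
    · by_contra h3
      rcases hc _ (Ne.symm h3) with h4 | h4
      · exact h2 h4
      · obtain ⟨u, hu⟩ := hτ
        exact Finset.disjoint_left.mp h4 (Finset.mem_insert_of_mem hu) (h hu)
  · refine Finset.sum_eq_zero fun v _ => ?_
    rw [if_neg fun h' => h ((Finset.subset_insert _ _).trans h'), ite_self]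

theorem reducedCycles_le_simplicialCycles (K : PreAbstractSimplicialComplex V) (k : ℕ) :
    reducedCycles K k ≤ simplicialCycles K k := by
  unfold simplicialCycles
  split_ifs with h
  · subst h
    exact inf_le_left
  · exact le_rfl

theorem simplicialCycles_le_chains (K : PreAbstractSimplicialComplex V) (k : ℕ) :
    simplicialCycles K k ≤ simplicialChains K k := by
  unfold simplicialCycles
  split_ifs with h
  · subst h
    exact le_rfl
  · exact inf_le_left

/-- The boundary is the augmented one, so that in degree `0` it may be non-zero at `∅`. -/
theorem simplicialBoundary_apply_of_mem_cycles {K : PreAbstractSimplicialComplex V} {k : ℕ}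
    {c : Finset V → ZMod 2} (hc : c ∈ simplicialCycles K k) {τ : Finset V} (hτ : τ.Nonempty) :
    simplicialBoundary V c τ = 0 := by
  unfold simplicialCycles at hc
  split_ifs at hc with h
  · rw [simplicialBoundary_apply]
    refine Finset.sum_eq_zero fun v _ => ?_
    split_ifs with hv
    · rfl
    · by_contra h'
      have := (mem_simplicialChains.mp hc _ h').2
      rw [Finset.card_insert_of_notMem hv] at this
      have := hτ.card_pos
      omega
  · exact congrFun hc.2 τ

theorem IsCone.subsingleton_reducedHomology {K : PreAbstractSimplicialComplex V} (hK : IsCone K)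
    (r : ℕ) : Subsingleton (ReducedHomology K r) := by
  obtain ⟨m, hm⟩ := hK
  rw [Submodule.Quotient.subsingleton_iff, Submodule.submoduleOf_eq_top]
  rintro c ⟨hc, hc'⟩
  refine ⟨coneChain m c, mem_simplicialChains.mpr fun σ hσ => ?_,
    simplicialBoundary_coneChain m hc'⟩
  simp only [coneChain, ne_eq, ite_eq_right_iff, Classical.not_imp] at hσ
  obtain ⟨h1, h2⟩ := mem_simplicialChains.mp hc _ hσ.2
  refine ⟨Finset.insert_erase hσ.1 ▸ hm _ h1, ?_⟩
  rw [← Finset.card_erase_add_one hσ.1, h2]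

end Chains

/-! ### Disjoint unions of boundaries of simplices -/

section SphereUnion

variable {V J : Type*} [Fintype V] [DecidableEq J]

/-- The fibre of `π` over `j`, as a finite set. -/
def fiberFinset (π : V → J) (j : J) : Finset V := Finset.univ.filter fun v => π v = j

@[simp]
theorem mem_fiberFinset {π : V → J} {j : J} {v : V} : v ∈ fiberFinset π j ↔ π v = j := by
  simp [fiberFinset]

/-- The disjoint union, over `j`, of the boundaries of the simplices spanned by the fibres of
`π : V → J`, where the simplices with `j ∈ S` are filled in. -/
def sphereUnion (π : V → J) (S : Set J) : PreAbstractSimplicialComplex V where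
  faces := {τ | τ.Nonempty ∧ ∃ j, τ ⊆ fiberFinset π j ∧ (τ ≠ fiberFinset π j ∨ j ∈ S)}
  isRelLowerSet_faces := fun _ ⟨hτ, j, hj, h⟩ => ⟨hτ, fun _ hρτ hρ => ⟨hρ, j, hρτ.trans hj,
    h.imp_left fun h h' => h (hj.antisymm (h' ▸ hρτ))⟩⟩

theorem mem_sphereUnion {π : V → J} {S : Set J} {τ : Finset V} : τ ∈ sphereUnion π S ↔
    τ.Nonempty ∧ ∃ j, τ ⊆ fiberFinset π j ∧ (τ ≠ fiberFinset π j ∨ j ∈ S) := Iff.rfl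

theorem sphereUnion_mono (π : V → J) {S S' : Set J} (h : S ⊆ S') :
    sphereUnion π S ≤ sphereUnion π S' :=
  fun _ ⟨hτ, j, hj, hS⟩ => ⟨hτ, j, hj, hS.imp_right fun hS => h hS⟩

theorem eq_of_nonempty_of_subset_fiberFinset {π : V → J} {τ : Finset V} {i j : J}
    (hτ : τ.Nonempty) (hi : τ ⊆ fiberFinset π i) (hj : τ ⊆ fiberFinset π j) : i = j := by
  obtain ⟨v, hv⟩ := hτ
  rw [← mem_fiberFinset.mp (hi hv), ← mem_fiberFinset.mp (hj hv)]

theorem subset_or_disjoint_fiberFinset {π : V → J} {S : Set J} {τ : Finset V}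
    (hτ : τ ∈ sphereUnion π S) (j : J) :
    τ ⊆ fiberFinset π j ∨ Disjoint τ (fiberFinset π j) := by
  obtain ⟨-, i, hi, -⟩ := hτ
  by_cases h : i = j
  · exact Or.inl (h ▸ hi)
  · refine Or.inr (Finset.disjoint_left.mpr fun v hv hv' => h ?_)
    rw [← mem_fiberFinset.mp (hi hv), ← mem_fiberFinset.mp hv']

variable [DecidableEq V] {π : V → J} {b : J → V} {d : J → ℕ} {S S' : Set J} {r : ℕ}

/-- A cycle in one fibre bounds in the sphere union unless it is the fundamental cycle of a sphere
that is not filled in; that is detected by its coefficient at the facet opposite to `b j`. -/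
theorem mem_boundaries_of_support_subset_fiber (hb : ∀ j, π (b j) = j)
    (hd : ∀ j, (fiberFinset π j).card = d j + 2) (j : J) {z : Finset V → ZMod 2}
    (hz : ∀ σ, z σ ≠ 0 → σ ⊆ fiberFinset π j ∧ σ.card = r + 1)
    (hz' : simplicialBoundary V z = 0)
    (h : d j = r → j ∉ S → z ((fiberFinset π j).erase (b j)) = 0) :
    z ∈ simplicialBoundaries (sphereUnion π S) r := by
  refine ⟨coneChain (b j) z, mem_simplicialChains.mpr fun σ hσ => ?_,
    simplicialBoundary_coneChain _ hz'⟩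
  simp only [coneChain, ne_eq, ite_eq_right_iff, Classical.not_imp] at hσ
  obtain ⟨h1, h2⟩ := hσ
  obtain ⟨h3, h4⟩ := hz _ h2
  have h5 := Finset.card_erase_add_one h1
  refine ⟨⟨⟨_, h1⟩, j, ?_, ?_⟩, by omega⟩
  · rw [← Finset.insert_erase h1]
    exact Finset.insert_subset (mem_fiberFinset.mpr (hb j)) h3
  · by_contra! h6
    rw [h6.1] at h2 h5 h4
    have := hd j
    exact h2 (h (by omega) h6.2)

/-- In a sphere that is not filled in, a facet is a proper face of no simplex of the complex. -/
theorem simplicialBoundary_apply_facet_eq_zero (hb : ∀ j, π (b j) = j)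
    (hd : ∀ j, (fiberFinset π j).card = d j + 2) {j : J} (hj : j ∉ S) {w : Finset V → ZMod 2}
    (hw : w ∈ simplicialChains (sphereUnion π S) r) :
    simplicialBoundary V w ((fiberFinset π j).erase (b j)) = 0 := by
  have hbj : b j ∈ fiberFinset π j := mem_fiberFinset.mpr (hb j)
  rw [simplicialBoundary_apply]
  refine Finset.sum_eq_zero fun v _ => ?_
  split_ifs with hv
  · rfl
  by_contra h
  obtain ⟨⟨-, i, hi, hi'⟩, -⟩ := mem_simplicialChains.mp hw _ h
  have hij : j = i := eq_of_nonempty_of_subset_fiberFinset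
    (τ := (fiberFinset π j).erase (b j)) (Finset.card_pos.mp (by
      rw [Finset.card_erase_of_mem hbj, hd]; omega)) (Finset.erase_subset _ _)
    ((Finset.subset_insert _ _).trans hi)
  subst hij
  have hvb : v = b j := by
    by_contra hne
    exact hv (Finset.mem_erase.mpr ⟨hne, hi (Finset.mem_insert_self _ _)⟩)
  rw [hvb, Finset.insert_erase hbj] at hi'
  exact hi'.elim (fun h => h rfl) hj

/-- The augmentation of a single fibre vanishes on boundaries, because no edge joins two fibres. -/
theorem sum_fiber_simplicialBoundary_eq_zero {w : Finset V → ZMod 2}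
    (hw : w ∈ simplicialChains (sphereUnion π S) 1) (j : J) :
    ∑ v ∈ fiberFinset π j, simplicialBoundary V w {v} = 0 := by
  have h := congrFun (simplicialBoundary_simplicialBoundary
    (restrictChain (fiberFinset π j) w)) ∅
  rw [simplicialBoundary_apply, Pi.zero_apply] at h
  rw [← h, ← Finset.sum_subset (Finset.subset_univ (fiberFinset π j))]
  · refine Finset.sum_congr rfl fun v hv => ?_
    rw [if_neg (Finset.notMem_empty v), insert_empty_eq,
      simplicialBoundary_restrictChain (fun σ hσ => subset_or_disjoint_fiberFinset
        (mem_simplicialChains.mp hw σ hσ).1 j) (Finset.singleton_nonempty v),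
      restrictChain, if_pos (Finset.singleton_subset_iff.mpr hv)]
  · intro v _ hv
    rw [if_neg (Finset.notMem_empty v), insert_empty_eq,
      simplicialBoundary_restrictChain (fun σ hσ => subset_or_disjoint_fiberFinset
        (mem_simplicialChains.mp hw σ hσ).1 j) (Finset.singleton_nonempty v),
      restrictChain, if_neg (fun h => hv (Finset.singleton_subset_iff.mp h))]

/-- The fundamental cycle of the sphere over `j`. -/
theorem simplicialBoundary_single_fiber_mem_reducedCycles
    (hd : ∀ j, (fiberFinset π j).card = d j + 2) (j : J) :
    simplicialBoundary V (Pi.single (fiberFinset π j) 1) ∈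
      reducedCycles (sphereUnion π S) (d j) := by
  refine ⟨?_, simplicialBoundary_simplicialBoundary _⟩
  rw [simplicialBoundary_single]
  refine Submodule.sum_mem _ fun v hv => mem_simplicialChains.mpr fun σ hσ => ?_
  have hσ : σ = (fiberFinset π j).erase v := by
    by_contra h
    exact hσ (Pi.single_eq_of_ne h _)
  have hcard : σ.card = d j + 1 := by rw [hσ, Finset.card_erase_of_mem hv, hd]; omega
  refine ⟨⟨Finset.card_pos.mp (by omega), j, hσ ▸ Finset.erase_subset _ _, Or.inl ?_⟩, hcard⟩
  rintro rfl
  rw [hd] at hcard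
  omega

theorem simplicialBoundary_single_fiber_apply_facet (hb : ∀ j, π (b j) = j)
    (hd : ∀ j, (fiberFinset π j).card = d j + 2) (i j : J) :
    simplicialBoundary V (Pi.single (fiberFinset π i) 1) ((fiberFinset π j).erase (b j)) =
      if i = j then 1 else 0 := by
  have hbj : b j ∈ fiberFinset π j := mem_fiberFinset.mpr (hb j)
  split_ifs with h
  · subst h
    rw [simplicialBoundary_apply, Fintype.sum_eq_single (b i)]
    · simp [Finset.insert_erase hbj]
    · intro v hv
      split_ifs with h
      · rfl
      · refine Pi.single_eq_of_ne (fun h' => h ?_) _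
        exact Finset.mem_erase.mpr ⟨hv, h' ▸ Finset.mem_insert_self _ _⟩
  · refine simplicialBoundary_apply_facet_eq_zero (S := {i}) (r := d i + 1) hb hd
      (fun h' => h (Set.mem_singleton_iff.mp h').symm) (mem_simplicialChains.mpr fun σ hσ => ?_)
    have hσ : σ = fiberFinset π i := by
      by_contra h
      exact hσ (Pi.single_eq_of_ne h _)
    subst hσ
    exact ⟨⟨Finset.card_pos.mp (by rw [hd]; omega), i, subset_rfl, Or.inr rfl⟩, hd i⟩


/-! ### Homology of disjoint unions of spheres -/

variable (π b d S r) in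
/-- The functionals that detect the homology of the sphere union in degree `r`: the coefficients at
the facets opposite to `b j` in the `r`-dimensional spheres that are not filled in and, if `r = 0`,
the sums of the coefficients over the fibres. -/
def homologyFunctional : (Finset V → ZMod 2) →ₗ[ZMod 2]
    ({j // d j = r ∧ j ∉ S} → ZMod 2) × ({_j : J // r = 0} → ZMod 2) :=
  LinearMap.prod
    (LinearMap.pi fun j => LinearMap.proj ((fiberFinset π j.1).erase (b j.1)))
    (LinearMap.pi fun j => ∑ v ∈ fiberFinset π j.1, LinearMap.proj {v})

theorem homologyFunctional_eq_zero_of_mem_boundaries (hb : ∀ j, π (b j) = j)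
    (hd : ∀ j, (fiberFinset π j).card = d j + 2) {z : Finset V → ZMod 2}
    (hz : z ∈ simplicialBoundaries (sphereUnion π S) r) :
    homologyFunctional π b d S r z = 0 := by
  obtain ⟨w, hw, rfl⟩ := hz
  refine Prod.ext (funext fun j => ?_) (funext fun j => ?_)
  · exact simplicialBoundary_apply_facet_eq_zero hb hd j.2.2 hw
  · obtain ⟨j, rfl⟩ := j
    simpa [homologyFunctional] using sum_fiber_simplicialBoundary_eq_zero hw j

/-- A cycle is the sum of its restrictions to the fibres, which bound if the functionals vanish. -/
theorem mem_boundaries_of_homologyFunctional_eq_zero [Fintype J] (hb : ∀ j, π (b j) = j)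
    (hd : ∀ j, (fiberFinset π j).card = d j + 2) {z : Finset V → ZMod 2}
    (hz : z ∈ simplicialCycles (sphereUnion π S) r) (h : homologyFunctional π b d S' r z = 0) :
    z ∈ simplicialBoundaries (sphereUnion π S') r := by
  have hzc := mem_simplicialChains.mp (simplicialCycles_le_chains _ _ hz)
  have hsum : z = ∑ j, restrictChain (fiberFinset π j) z := by
    ext σ
    rw [Finset.sum_apply]
    by_cases hσ : z σ = 0
    · simp [restrictChain, hσ]
    · obtain ⟨⟨hσ', j, hj, -⟩, -⟩ := hzc σ hσ
      rw [Fintype.sum_eq_single j]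
      · simp [restrictChain, hj]
      · intro i hi
        rw [restrictChain, if_neg]
        exact fun h => hi (eq_of_nonempty_of_subset_fiberFinset hσ' h hj)
  rw [hsum]
  refine Submodule.sum_mem _ fun j _ => mem_boundaries_of_support_subset_fiber hb hd j ?_ ?_ ?_
  · intro σ hσ
    simp only [restrictChain, ne_eq, ite_eq_right_iff, Classical.not_imp] at hσ
    exact ⟨hσ.1, (hzc σ hσ.2).2⟩
  · ext τ
    rcases τ.eq_empty_or_nonempty with rfl | hτ
    · rw [simplicialBoundary_apply, Pi.zero_apply]
      by_cases hr : r = 0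
      · have := congrFun (congrArg Prod.snd h) ⟨j, hr⟩
        simp only [homologyFunctional, LinearMap.prod_apply, Function.prod_apply,
          LinearMap.pi_apply, LinearMap.sum_apply, LinearMap.proj_apply, Prod.snd_zero,
          Pi.zero_apply] at this
        rw [← this, ← Finset.sum_subset (Finset.subset_univ (fiberFinset π j))]
        · exact Finset.sum_congr rfl fun v hv => by
            simp [restrictChain, mem_fiberFinset.mp hv]
        · intro v _ hv
          simpa [restrictChain] using fun h => absurd h (mt mem_fiberFinset.mpr hv)
      · refine Finset.sum_eq_zero fun v _ => ?_
        simp only [Finset.notMem_empty, if_false, insert_empty_eq, restrictChain]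
        split_ifs
        · by_contra h'
          have := (hzc _ h').2
          simp at this
          omega
        · rfl
    · rw [simplicialBoundary_restrictChain (fun σ hσ =>
        subset_or_disjoint_fiberFinset (hzc σ hσ).1 j) hτ, restrictChain,
        simplicialBoundary_apply_of_mem_cycles hz hτ, ite_self, Pi.zero_apply]
  · intro hj hjS
    have := congrFun (congrArg Prod.fst h) ⟨j, hj, hjS⟩
    rw [restrictChain, if_pos (Finset.erase_subset _ _)]
    exact this

theorem homologyFunctional_single (hb : ∀ j, π (b j) = j) (j : {_j : J // r = 0}) :
    homologyFunctional π b d S r (Pi.single {b j.1} 1) = (0, Pi.single j 1) := by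
  refine Prod.ext (funext fun i => ?_) (funext fun i => ?_)
  · refine Pi.single_eq_of_ne (fun h => ?_) _
    have h1 : b j.1 ∈ (fiberFinset π i.1).erase (b i.1) := h ▸ Finset.mem_singleton_self _
    obtain ⟨h2, h3⟩ := Finset.mem_erase.mp h1
    rw [mem_fiberFinset, hb] at h3
    exact h2 (congrArg b h3)
  · simp only [homologyFunctional, LinearMap.prod_apply, Function.prod_apply, LinearMap.pi_apply,
      LinearMap.sum_apply, LinearMap.proj_apply, Pi.single_apply, Finset.singleton_inj]
    rw [Finset.sum_ite_eq']
    simp [hb, Subtype.ext_iff, eq_comm]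

theorem homologyFunctional_simplicialBoundary_single (hb : ∀ j, π (b j) = j)
    (hd : ∀ j, (fiberFinset π j).card = d j + 2) (j : {j // d j = r ∧ j ∉ S}) :
    homologyFunctional π b d S r (simplicialBoundary V (Pi.single (fiberFinset π j.1) 1)) =
      (Pi.single j 1, 0) := by
  refine Prod.ext (funext fun i => ?_) (funext fun i => ?_)
  · refine (simplicialBoundary_single_fiber_apply_facet hb hd j.1 i.1).trans ?_
    simp [Pi.single_apply, Subtype.ext_iff, eq_comm]
  · simp only [homologyFunctional, LinearMap.prod_apply, Function.prod_apply, LinearMap.pi_apply,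
      LinearMap.sum_apply, LinearMap.proj_apply, Pi.zero_apply]
    refine sum_fiber_simplicialBoundary_eq_zero (S := Set.univ) ?_ i.1
    refine mem_simplicialChains.mpr fun σ hσ => ?_
    have hσ : σ = fiberFinset π j.1 := by
      by_contra h
      exact hσ (Pi.single_eq_of_ne h _)
    have h0 : (fiberFinset π j.1).card = r + 2 := by rw [hd, j.2.1]
    have hr := i.2
    subst hσ
    exact ⟨⟨Finset.card_pos.mp (by omega), j.1, subset_rfl, Or.inr trivial⟩, by omega⟩

/-- The vertices `b j` and the fundamental cycles form a dual system of cycles, whatever is filled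
in. -/
theorem map_homologyFunctional_simplicialCycles [Fintype J] (hb : ∀ j, π (b j) = j)
    (hd : ∀ j, (fiberFinset π j).card = d j + 2) :
    (simplicialCycles (sphereUnion π S) r).map (homologyFunctional π b d S' r) = ⊤ := by
  classical
  rw [eq_top_iff]
  rintro ⟨x, y⟩ -
  have h1 : ((x, y) : ({j // d j = r ∧ j ∉ S'} → ZMod 2) × ({_j : J // r = 0} → ZMod 2)) =
      ∑ j, x j • (Pi.single j 1, 0) + ∑ j, y j • (0, Pi.single j 1) := by
    refine Prod.ext (funext fun i => ?_) (funext fun i => ?_)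
    · simp [Prod.fst_sum, Finset.sum_apply, Pi.single_apply]
    · simp [Prod.snd_sum, Finset.sum_apply, Pi.single_apply]
  rw [h1]
  refine Submodule.add_mem _ (Submodule.sum_mem _ fun j _ => Submodule.smul_mem _ _ ?_)
    (Submodule.sum_mem _ fun j _ => Submodule.smul_mem _ _ ?_)
  · rw [← homologyFunctional_simplicialBoundary_single hb hd j]
    refine Submodule.mem_map_of_mem (reducedCycles_le_simplicialCycles _ _ ?_)
    have := simplicialBoundary_single_fiber_mem_reducedCycles (S := S) hd j.1
    rwa [j.2.1] at this
  · rw [← homologyFunctional_single hb j]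
    refine Submodule.mem_map_of_mem ?_
    rw [simplicialCycles, if_pos j.2]
    refine mem_simplicialChains.mpr fun σ hσ => ?_
    have hσ : σ = {b j.1} := by
      by_contra h
      exact hσ (Pi.single_eq_of_ne h _)
    subst hσ
    refine ⟨⟨Finset.singleton_nonempty _, j.1, by simp [hb], Or.inl fun h => ?_⟩, by simp⟩
    have := hd j.1
    rw [← h, Finset.card_singleton] at this
    omega

/-- If a linear map `φ` detects which elements of `Z` lie in `B'`, then the map `Z / B → Z' / B'`
has the same rank as `φ` on `Z`. -/
theorem finrank_range_mapQ_inclusion {k E W : Type*} [Field k] [AddCommGroup E] [Module k E]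
    [AddCommGroup W] [Module k W] {Z Z' B B' : Submodule k E} (hZ : Z ≤ Z')
    (hB : B.submoduleOf Z ≤ (B'.submoduleOf Z').comap (Submodule.inclusion hZ)) (φ : E →ₗ[k] W)
    (hφ : ∀ z ∈ Z, φ z = 0 ↔ z ∈ B') :
    Module.finrank k (LinearMap.range
      (Submodule.mapQ (B.submoduleOf Z) (B'.submoduleOf Z') (Submodule.inclusion hZ) hB)) =
        Module.finrank k (Z.map φ) := by
  let f := (B'.submoduleOf Z').mkQ ∘ₗ Submodule.inclusion hZ
  have h1 : LinearMap.range (Submodule.mapQ (B.submoduleOf Z) (B'.submoduleOf Z')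
      (Submodule.inclusion hZ) hB) = LinearMap.range f := by
    rw [← LinearMap.range_comp_of_range_eq_top _ (Submodule.range_mkQ (B.submoduleOf Z)),
      Submodule.mapQ_mkQ]
  have h2 : Z.map φ = LinearMap.range (φ ∘ₗ Z.subtype) := by
    rw [LinearMap.range_comp, Submodule.range_subtype]
  have h3 : LinearMap.ker f = LinearMap.ker (φ ∘ₗ Z.subtype) := by
    ext ⟨z, hz⟩
    rw [LinearMap.mem_ker, LinearMap.mem_ker]
    exact (Submodule.Quotient.mk_eq_zero _).trans (hφ z hz).symm
  rw [h1, h2]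
  exact (f.quotKerEquivRange.symm ≪≫ₗ Submodule.quotEquivOfEq _ _ h3 ≪≫ₗ
    (φ ∘ₗ Z.subtype).quotKerEquivRange).finrank_eq

open scoped Classical in
/-- The rank of the maps on homology that are induced by filling in more spheres. -/
theorem finrank_range_simplicialHomologyMap_sphereUnion [Fintype J] (hπ : Function.Surjective π)
    (hd : ∀ j, (fiberFinset π j).card = d j + 2)
    (h : sphereUnion π S ≤ sphereUnion π S') (r : ℕ) :
    Module.finrank (ZMod 2) (LinearMap.range (simplicialHomologyMap h r)) =
      (Finset.univ.filter fun j => d j = r ∧ j ∉ S').card +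
        if r = 0 then Fintype.card J else 0 := by
  obtain ⟨b, hb⟩ := hπ.hasRightInverse
  have := finrank_range_mapQ_inclusion (simplicialCycles_mono h r)
    (fun _ hx => simplicialBoundaries_mono h r hx :
      (simplicialBoundaries (sphereUnion π S) r).submoduleOf _ ≤ _)
    (homologyFunctional π b d S' r)
    (fun z hz => ⟨mem_boundaries_of_homologyFunctional_eq_zero hb hd hz,
      homologyFunctional_eq_zero_of_mem_boundaries hb hd⟩)
  refine this.trans ?_
  rw [map_homologyFunctional_simplicialCycles hb hd, finrank_top, Module.finrank_prod,
    Module.finrank_pi, Module.finrank_pi, Fintype.card_subtype, Fintype.card_subtype]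
  congr 1
  split_ifs with h <;> simp [h]

open scoped Classical in
/-- A single sphere has reduced homology of rank one in its dimension, as long as it is not filled
in. -/
theorem finrank_reducedHomology_sphereUnion [Unique J] (hπ : Function.Surjective π)
    (hd : ∀ j, (fiberFinset π j).card = d j + 2) (r : ℕ) :
    Module.finrank (ZMod 2) (ReducedHomology (sphereUnion π S) r) =
      if r = d default ∧ default ∉ S then 1 else 0 := by
  obtain ⟨b, hb⟩ := hπ.hasRightInverse
  have huniv : fiberFinset π default = Finset.univ := by
    ext v
    simp [Subsingleton.elim (π v) default]
  let φ : (Finset V → ZMod 2) →ₗ[ZMod 2] ({j // d j = r ∧ j ∉ S} → ZMod 2) :=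
    LinearMap.fst _ _ _ ∘ₗ homologyFunctional π b d S r
  have hφ : ∀ z ∈ reducedCycles (sphereUnion π S) r,
      φ z = 0 ↔ z ∈ simplicialBoundaries (sphereUnion π S) r := by
    refine fun z hz => ⟨fun h => ?_, fun h => ?_⟩
    · refine mem_boundaries_of_support_subset_fiber hb hd default (fun σ hσ => ?_) hz.2
        fun h1 h2 => congrFun h ⟨default, h1, h2⟩
      exact ⟨huniv ▸ Finset.subset_univ σ, (mem_simplicialChains.mp hz.1 σ hσ).2⟩
    · exact congrArg Prod.fst (homologyFunctional_eq_zero_of_mem_boundaries hb hd h)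
  have h1 : Module.finrank (ZMod 2)
      (LinearMap.range (reducedHomologyMap (le_refl (sphereUnion π S)) r)) = _ :=
    finrank_range_mapQ_inclusion _ _ φ hφ
  have h2 : (reducedCycles (sphereUnion π S) r).map φ = ⊤ := by
    rw [eq_top_iff]
    rintro x -
    have hx : x = ∑ j, x j • Pi.single j 1 := by
      ext i
      simp [Pi.single_apply]
    rw [hx]
    refine Submodule.sum_mem _ fun j _ => Submodule.smul_mem _ _ ⟨_, ?_,
      congrArg Prod.fst (homologyFunctional_simplicialBoundary_single hb hd j)⟩
    have := simplicialBoundary_single_fiber_mem_reducedCycles (S := S) hd j.1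
    rwa [j.2.1] at this
  have h3 : LinearMap.range (reducedHomologyMap (le_refl (sphereUnion π S)) r) = ⊤ := by
    rw [LinearMap.range_eq_top]
    rintro ⟨x⟩
    exact ⟨Submodule.Quotient.mk x, rfl⟩
  rw [h3, finrank_top, h2, finrank_top, Module.finrank_pi, Fintype.card_subtype] at h1
  refine h1.trans ?_
  rw [Finset.univ_unique, Finset.filter_singleton, apply_ite Finset.card]
  simp [eq_comm]

end SphereUnion

/-! ### Persistence diagrams of sphere filtrations -/

section Diagram

variable {J : Type*}

open scoped Classical in
/-- The diagram of a module whose features are all born at `0`: the feature `j ∈ A` dies at `T j`,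
and `c` features never die. -/
theorem PersistenceModule.multiplicity_eq (M : PersistenceModule) (A : Finset J) (T : J → ℝ)
    (c : ℕ) (hM : ∀ s t, M.rank s t =
      if 0 ≤ s ∧ s ≤ t then (A.filter fun j => t < T j).card + c else 0)
    {x : ℝ} {y : EReal} (hxy : (x : EReal) < y) :
    M.multiplicity (x, y) = if x = 0 then
      if y = ⊤ then c else (A.filter fun j => (T j : EReal) = y).card else 0 := by
  have hneg : ∀ s < 0, ∀ t, M.rank s t = 0 := fun s hs t => by
    rw [hM, if_neg (fun h => absurd h.1 (not_le.mpr hs))]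
  have hnegExt : ∀ s < 0, ∀ t, M.rankExt s t = 0 := fun s hs t => by
    rw [rankExt]; split_ifs; exacts [rfl, hneg s hs _]
  have htop : ∀ s, M.rankExt s ⊤ = 0 := fun s => by simp [rankExt]
  unfold PersistenceModule.multiplicity
  rcases lt_trichotomy x 0 with hx | rfl | hx
  · -- all ranks at negative scales vanish
    rw [if_neg hx.ne]
    obtain ⟨z, hz1, hz2⟩ := EReal.lt_iff_exists_real_btwn.mp
      (lt_min hxy (EReal.coe_lt_coe_iff.mpr hx))
    have hz3 := lt_min_iff.mp hz2
    refine Nat.sInf_eq_zero.mpr (Or.inl ⟨x - 1, z, z, ⊤, by simp, EReal.coe_lt_coe_iff.mp hz1,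
      le_rfl, hz3.1, ?_, ?_⟩)
    · exact (lt_or_eq_of_le le_top).imp_right fun h => ⟨h, rfl⟩
    · simp [measure, hneg z (EReal.coe_lt_coe_iff.mp hz3.2), hneg (x - 1) (by linarith), htop]
  · have hms : ∀ a b t : ℝ, ∀ d : EReal, a < 0 → 0 < b → b ≤ t →
        M.measure a b t d = (A.filter fun j => t < T j).card + c - M.rankExt b d := by
      intro a b t d ha hb hbt
      simp [measure, hneg a ha, hnegExt a ha, hM b t, hb.le, hbt]
    have hy : 0 < y := hxy
    rw [if_pos rfl]
    -- beyond `R` only the features that never die are left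
    obtain ⟨R, hR⟩ : ∃ R : ℝ, ∀ j ∈ A, T j < R := by
      obtain ⟨R, hR⟩ := (A.image T).finite_toSet.bddAbove
      exact ⟨R + 1, fun j hj => (hR (Finset.mem_coe.mpr
        (Finset.mem_image_of_mem T hj))).trans_lt (lt_add_one R)⟩
    have hcount : ∀ t, R ≤ t → (A.filter fun j => t < T j).card = 0 := fun t ht => by
      rw [Finset.card_eq_zero, Finset.filter_eq_empty_iff]
      exact fun j hj h => absurd (hR j hj) (not_lt.mpr (ht.trans h.le))
    induction y with
    | bot => exact absurd hy (by simp)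
    | top =>
      rw [if_pos rfl]
      refine IsLeast.csInf_eq ⟨⟨-1, 1, max 1 R, ⊤, by norm_num, by norm_num, le_max_left _ _,
        EReal.coe_lt_top _, Or.inr ⟨rfl, rfl⟩, ?_⟩, ?_⟩
      · rw [hms _ _ _ _ (by norm_num) one_pos (le_max_left _ _), htop, hcount _ (le_max_right _ _)]
        simp
      · rintro m ⟨a, b, t, d, ha, hb, hbt, -, hd, rfl⟩
        rcases hd with hd | ⟨-, rfl⟩
        · exact absurd hd not_top_lt
        · rw [hms a b t _ ha hb hbt, htop]
          omega
    | coe y =>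
      have hy : 0 < y := EReal.coe_pos.mp hy
      rw [if_neg (EReal.coe_ne_top y)]
      simp only [EReal.coe_eq_coe_iff]
      have hrank : ∀ b u : ℝ, 0 < b → b ≤ u →
          M.rankExt b u = (A.filter fun j => u < T j).card + c := by
        intro b u hb hbu
        simp [rankExt, hM, hb.le, hbu]
      -- the features that die in `(t, u]`
      have hdiff : ∀ t u : ℝ, t ≤ u → (A.filter fun j => t < T j).card =
          (A.filter fun j => t < T j ∧ T j ≤ u).card + (A.filter fun j => u < T j).card := by
        intro t u htu
        rw [← Finset.card_filter_add_card_filter_not (s := A.filter fun j => t < T j)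
          (fun j => T j ≤ u), Finset.filter_filter, Finset.filter_filter]
        congr 2
        ext j
        simp only [Finset.mem_filter, not_le]
        exact ⟨fun h => ⟨h.1, h.2.2⟩, fun h => ⟨h.1, htu.trans_lt h.2, h.2⟩⟩
      refine IsLeast.csInf_eq ⟨?_, ?_⟩
      · -- a rectangle so small that no other feature dies in it
        have hev : ∀ᶠ δ : ℝ in nhdsWithin 0 (Set.Ioi 0), δ < y / 2 ∧
            ∀ j ∈ A, T j ≠ y → δ < |T j - y| := by
          refine Filter.Eventually.and ?_ ((Filter.eventually_all_finset A).mpr fun j _ => ?_)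
          · exact Filter.Eventually.filter_mono nhdsWithin_le_nhds
              (gt_mem_nhds (by linarith))
          · by_cases h : T j = y
            · simp [h]
            · exact Filter.Eventually.filter_mono nhdsWithin_le_nhds
                ((gt_mem_nhds (abs_pos.mpr (sub_ne_zero.mpr h))).mono fun _ h' _ => h')
        obtain ⟨δ, ⟨hδ1, hδ2⟩, hδ0⟩ := (hev.and self_mem_nhdsWithin).exists
        have hδ0 : 0 < δ := hδ0
        refine ⟨-1, y - δ, y - δ, ((y + δ : ℝ) : EReal), by norm_num, show 0 < y - δ by linarith,
          le_rfl, EReal.coe_lt_coe_iff.mpr (by linarith),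
          Or.inl (EReal.coe_lt_coe_iff.mpr (by linarith)), ?_⟩
        rw [hms _ _ _ _ (by norm_num) (by linarith) le_rfl, hrank _ _ (by linarith) (by linarith),
          hdiff (y - δ) (y + δ) (by linarith)]
        have : (A.filter fun j => y - δ < T j ∧ T j ≤ y + δ) = A.filter fun j => T j = y := by
          refine Finset.filter_congr fun j hj => ⟨fun h => ?_, fun h => ?_⟩
          · by_contra hne
            have := hδ2 j hj hne
            rcases abs_cases (T j - y) with h' | h' <;> linarith
          · rw [h]; constructor <;> linarith
        rw [this]
        omega
      · rintro m ⟨a, b, t, d, ha, hb, hbt, hty, hd, rfl⟩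
        have hty : t < y := EReal.coe_lt_coe_iff.mp hty
        have hb : 0 < b := hb
        have hd : (y : EReal) < d := hd.resolve_right fun h => EReal.coe_ne_top y h.1
        rw [hms a b t d ha hb hbt]
        induction d with
        | bot => exact absurd hd (by simp)
        | top =>
          rw [htop]
          have : (A.filter fun j => T j = y).card ≤ (A.filter fun j => t < T j).card :=
            Finset.card_le_card (Finset.monotone_filter_right A
              fun j _ (h : T j = y) => h ▸ hty)
          omega
        | coe u =>
          have hyu : y < u := EReal.coe_lt_coe_iff.mp hd
          rw [hrank b u hb (by linarith), hdiff t u (by linarith)]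
          have : (A.filter fun j => T j = y).card ≤
              (A.filter fun j => t < T j ∧ T j ≤ u).card :=
            Finset.card_le_card (Finset.monotone_filter_right A
              fun j _ (h : T j = y) => h ▸ ⟨hty, hyu.le⟩)
          omega
  · -- features born at `0` are alive on both sides of `x`
    rw [if_neg hx.ne']
    obtain ⟨z, hz1, hz2⟩ := EReal.lt_iff_exists_real_btwn.mp hxy
    have hz1 := EReal.coe_lt_coe_iff.mp hz1
    refine Nat.sInf_eq_zero.mpr (Or.inl ⟨x / 2, z, z, ⊤, half_lt_self hx, hz1,
      le_rfl, hz2, ?_, ?_⟩)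
    · exact (lt_or_eq_of_le le_top).imp_right fun h => ⟨h, rfl⟩
    · have h1 : 0 ≤ z := by linarith
      have h2 : 0 ≤ x / 2 := by linarith
      have h3 : x / 2 ≤ z := by linarith
      simp [measure, htop, hM, h1, h2, h3]

variable {V : Type} [Fintype V] [DecidableEq V] [DecidableEq J]

/-- The sphere over `j` is filled in at the scale `T j`. -/
def sphereFiltration (π : V → J) (T : J → ℝ≥0) : SimplicialFiltration V where
  toFun α := sphereUnion π {j | T j ≤ α}
  monotone' _ _ h := sphereUnion_mono π fun _ hj => le_trans hj h

variable [Fintype J] {π : V → J} {d : J → ℕ} {T : J → ℝ≥0}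

open scoped Classical in
theorem rank_persistentHomology_sphereFiltration (hπ : Function.Surjective π)
    (hd : ∀ j, (fiberFinset π j).card = d j + 2) (r : ℕ) (s t : ℝ) :
    (persistentHomology (sphereFiltration π T) r).rank s t = if 0 ≤ s ∧ s ≤ t then
      ((Finset.univ.filter fun j => d j = r).filter fun j => t < T j).card +
        (if r = 0 then Fintype.card J else 0) else 0 := by
  by_cases h : 0 ≤ s ∧ s ≤ t
  · rw [PersistenceModule.rank, dif_pos h, if_pos h]
    refine (finrank_range_simplicialHomologyMap_sphereUnion hπ hd
      ((sphereFiltration π T).monotone (Real.toNNReal_le_toNNReal h.2)) r).trans ?_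
    rw [Finset.filter_filter]
    simp only [Set.mem_ofPred_eq, Real.le_toNNReal_iff_coe_le (h.1.trans h.2), not_le]
  · rw [PersistenceModule.rank, dif_neg h, if_neg h]

open scoped Classical in
theorem Dgm_sphereFiltration (hπ : Function.Surjective π)
    (hd : ∀ j, (fiberFinset π j).card = d j + 2) (r : ℕ) {x : ℝ} {y : EReal}
    (hxy : (x : EReal) < y) : Dgm r (sphereFiltration π T) (x, y) = ((if x = 0 then
      if y = ⊤ then if r = 0 then Fintype.card J else 0
      else (Finset.univ.filter fun j => d j = r ∧ ((T j : ℝ) : EReal) = y).card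
      else 0 : ℕ) : ℕ∞) := by
  rw [Dgm, PersistenceModule.diagram, if_pos hxy, PersistenceModule.multiplicity_eq _
    (Finset.univ.filter fun j => d j = r) (fun j => (T j : ℝ)) _
    (rank_persistentHomology_sphereFiltration hπ hd r) hxy, Finset.filter_filter]

end Diagram

/-! ### Bottleneck distances -/

section Bottleneck

theorem extendedDist_coe (x y : ℝ) : extendedDist x y = ENNReal.ofReal |x - y| := by
  unfold extendedDist
  split_ifs with h
  · simp [EReal.coe_eq_coe_iff.mp h]
  · rw [← EReal.coe_sub, EReal.abs_def]

theorem extendedDist_self (x : EReal) : extendedDist x x = 0 := if_pos rfl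

/-- Diagrams that differ by a transposition of `P` and `Q`, with `P` in the first diagram only, can
be matched at the cost of moving `P` to `Q`. -/
theorem bottleneckDist_le_of_swap [DecidableEq (ℝ × EReal)] {D D' : PersistenceDiagram}
    {P Q : ℝ × EReal} (h : ∀ p, D p = D' (Equiv.swap P Q p)) (hQ : D Q = 0) :
    bottleneckDist D D' ≤ planeDist P Q := by
  let φ : D.Elements ≃ D'.Elements := Equiv.sigmaCongr (Equiv.swap P Q) fun p =>
    Equiv.subtypeEquivRight fun i => by rw [h p]
  refine (iInf_le _ φ).trans (iSup_le fun x => ?_)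
  have hφ : (φ x).1 = Equiv.swap P Q x.1 := rfl
  rw [hφ]
  by_cases h1 : x.1 = P
  · rw [h1, Equiv.swap_apply_left]
  · have h2 : x.1 ≠ Q := fun h2 => by
      exact ne_bot_of_gt x.2.2 (by rw [h2, hQ]; rfl)
    rw [Equiv.swap_apply_of_ne_of_ne h1 h2]
    simp [planeDist, extendedDist_self]

/-- A point of `D'` that is at distance at least `δ` from all points of `D` bounds the bottleneck
distance from below. -/
theorem le_bottleneckDist {D D' : PersistenceDiagram} {Q : ℝ × EReal} {δ : ℝ≥0∞} (hQ : D' Q ≠ 0)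
    (h : ∀ p, D p ≠ 0 → δ ≤ planeDist p Q) : δ ≤ bottleneckDist D D' := by
  refine le_iInf fun φ => ?_
  let q : D'.Elements := ⟨Q, 0, by simpa using pos_iff_ne_zero.mpr hQ⟩
  refine le_trans ?_ (le_iSup _ (φ.symm q))
  rw [Equiv.apply_symm_apply]
  exact h _ (ne_bot_of_gt (φ.symm q).2.2)

variable {J : Type*} {V : Type} [Fintype V] [DecidableEq V] [DecidableEq J] [Fintype J]
  {π : V → J} {d : J → ℕ}

/-- If only one of the spheres has dimension `r`, and its filling is delayed from `t` to `2 * t`,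
then the best matching moves the point `(0, t)` to `(0, 2 * t)`: the distance of `(0, 2 * t)` from
the diagonal is `t` as well. -/
theorem bottleneckDist_sphereFiltration (hπ : Function.Surjective π)
    (hd : ∀ j, (fiberFinset π j).card = d j + 2) {r : ℕ} {j : J} (hj : ∀ i, d i = r ↔ i = j)
    {T T' : J → ℝ≥0} {t : ℝ≥0} (ht : 0 < t) (hT : T j = t) (hT' : T' j = 2 * t) :
    bottleneckDist (Dgm r (sphereFiltration π T)) (Dgm r (sphereFiltration π T')) = t := by
  classical
  have ht' : (0 : ℝ) < t := ht
  have key : ∀ (T : J → ℝ≥0) (x : ℝ) (y : EReal), (x : EReal) < y →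
      Dgm r (sphereFiltration π T) (x, y) = ((if x = 0 then
        if y = ⊤ then if r = 0 then Fintype.card J else 0
        else if ((T j : ℝ) : EReal) = y then 1 else 0 else 0 : ℕ) : ℕ∞) := by
    intro T x y hxy
    rw [Dgm_sphereFiltration hπ hd r hxy]
    congr 4
    simp only [hj, Finset.filter_and, Finset.filter_eq', Finset.mem_univ, if_true,
      Finset.singleton_inter, Finset.mem_filter, true_and]
    split_ifs <;> rfl
  have hdiag : ∀ (T : J → ℝ≥0) (x : ℝ) (y : EReal), ¬ (x : EReal) < y →
      Dgm r (sphereFiltration π T) (x, y) = if (x : EReal) = y then ⊤ else 0 := by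
    intro T x y hxy
    rw [Dgm, PersistenceModule.diagram, if_neg hxy]
  obtain ⟨u, hu⟩ : ∃ u : ℝ, u = 2 * t := ⟨_, rfl⟩
  set P : ℝ × EReal := (0, ((t : ℝ) : EReal)) with hP
  set Q : ℝ × EReal := (0, (u : EReal)) with hQ
  have hP0 : ((0 : ℝ) : EReal) < ((t : ℝ) : EReal) := EReal.coe_lt_coe_iff.mpr ht'
  have hQ0 : ((0 : ℝ) : EReal) < (u : EReal) :=
    EReal.coe_lt_coe_iff.mpr (by linarith)
  have hPQ : ((t : ℝ) : EReal) ≠ (u : EReal) :=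
    fun h => by linarith [EReal.coe_eq_coe_iff.mp h]
  have hTr : ((T j : ℝ) : EReal) = ((t : ℝ) : EReal) := by rw [hT]
  have hTr' : ((T' j : ℝ) : EReal) = (u : EReal) := by rw [hT', hu]; push_cast; rfl
  refine le_antisymm ?_ ?_
  · have hdist : planeDist P Q = t := by
      simp only [planeDist, hP, hQ, extendedDist_self, extendedDist_coe]
      rw [show (t : ℝ) - u = -t by linarith, abs_neg, abs_of_pos ht', max_eq_right zero_le,
        ENNReal.ofReal_coe_nnreal]
    rw [← hdist]
    refine bottleneckDist_le_of_swap ?_ ?_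
    · intro p
      by_cases h1 : p = P
      · rw [h1, Equiv.swap_apply_left, hP, hQ, key _ _ _ hP0, key _ _ _ hQ0, hTr, hTr']
        simp
      by_cases h2 : p = Q
      · rw [h2, Equiv.swap_apply_right, hP, hQ, key _ _ _ hP0, key _ _ _ hQ0, hTr, hTr']
        simp [hPQ, hPQ.symm]
      rw [Equiv.swap_apply_of_ne_of_ne h1 h2]
      obtain ⟨x, y⟩ := p
      by_cases hxy : (x : EReal) < y
      · rw [key _ _ _ hxy, key _ _ _ hxy, hTr, hTr']
        by_cases hx : x = 0
        · subst hx
          have h1 : ((t : ℝ) : EReal) ≠ y := fun h => h1 (by rw [hP, h])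
          have h2 : (u : EReal) ≠ y := fun h => h2 (by rw [hQ, h])
          rw [if_neg h1, if_neg h2]
        · rw [if_neg hx, if_neg hx]
      · rw [hdiag _ _ _ hxy, hdiag _ _ _ hxy]
    · rw [hQ, key _ _ _ hQ0, hTr]
      simp [hPQ]
  · refine le_bottleneckDist (Q := Q) ?_ ?_
    · rw [hQ, key _ _ _ hQ0, hTr']
      simp
    · rintro ⟨x, y⟩ hp
      rw [← ENNReal.ofReal_coe_nnreal]
      by_cases hxy : (x : EReal) < y
      · rw [key _ _ _ hxy, hTr] at hp
        have hy : y = ⊤ ∨ ((t : ℝ) : EReal) = y := by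
          by_contra! h
          simp [h.1, h.2] at hp
        refine le_max_of_le_right ?_
        rcases hy with rfl | rfl
        · show _ ≤ extendedDist ⊤ _
          rw [extendedDist, if_neg (EReal.coe_ne_top _).symm, EReal.top_sub_coe, EReal.abs_top]
          exact le_top
        · show _ ≤ extendedDist _ _
          rw [extendedDist_coe]
          refine ENNReal.ofReal_le_ofReal ?_
          rw [show (t : ℝ) - u = -t by linarith, abs_neg]
          exact le_abs_self _
      · rw [hdiag _ _ _ hxy] at hp
        have hxy' : (x : EReal) = y := by
          by_contra h
          simp [h] at hp
        subst hxy'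
        simp only [planeDist, hQ, extendedDist_coe]
        rw [← ENNReal.ofReal_max]
        refine ENNReal.ofReal_le_ofReal ?_
        rcases le_total x t with h | h
        · refine le_max_of_le_right (le_trans ?_ (neg_le_abs _))
          linarith
        · refine le_max_of_le_left (le_trans ?_ (le_abs_self _))
          linarith

end Bottleneck

/-! ### Unions, intersections and nerves of covers -/

section Cover

variable {V ι : Type*}

theorem mem_iSup_complex {K : ι → PreAbstractSimplicialComplex V} {τ : Finset V} :
    τ ∈ ⨆ i, K i ↔ ∃ i, τ ∈ K i := by
  change τ ∈ ⋃ L ∈ Set.range K, L.faces ↔ _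
  simp only [Set.mem_range, Set.iUnion_exists, Set.iUnion_iUnion_eq', Set.mem_iUnion]
  rfl

/-- The non-emptiness matters if the index type is empty: that infimum is the complex of all
non-empty sets. -/
theorem mem_iInf_complex {ι : Sort*} {K : ι → PreAbstractSimplicialComplex V} {τ : Finset V} :
    τ ∈ ⨅ i, K i ↔ τ.Nonempty ∧ ∀ i, τ ∈ K i := by
  change τ ∈ (⋂ L ∈ Set.range K, L.faces) ∩ {t | t.Nonempty} ↔ _
  simp only [Set.mem_range, Set.iInter_exists, Set.iInter_iInter_eq', Set.mem_inter_iff,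
    Set.mem_iInter, Set.mem_ofPred_eq]
  exact and_comm

namespace CoverFiltration

theorem mem_union {U : CoverFiltration ι V} {α : ℝ≥0} {τ : Finset V} :
    τ ∈ U.union α ↔ ∃ i, τ ∈ U i α :=
  mem_iSup_complex

theorem mem_inter {U : CoverFiltration ι V} {v : Finset ι} {α : ℝ≥0} {τ : Finset V} :
    τ ∈ U.inter v α ↔ τ.Nonempty ∧ ∀ i ∈ v, τ ∈ U i α := by
  change τ ∈ ⨅ i ∈ v, U i α ↔ _
  simp only [mem_iInf_complex]
  exact ⟨fun h => ⟨h.1, fun i hi => (h.2 i).2 hi⟩, fun h => ⟨h.1, fun i => ⟨h.1, h.2 i⟩⟩⟩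

theorem mem_nerve {U : CoverFiltration ι V} {α : ℝ≥0} {v : Finset ι} :
    v ∈ U.nerve α ↔ v.Nonempty ∧ ∃ τ, τ ∈ U.inter v α := Iff.rfl

theorem inter_rescale (U : CoverFiltration ι V) (ε : ℝ≥0) (v : Finset ι) (α : ℝ≥0) :
    (U.rescale ε).inter v α = U.inter v (α / ε) := by
  ext1
  rfl

section DisjointUnion

variable {J : Type*} {ι V : J → Type*} [DecidableEq (Σ j, V j)]
  {U : ∀ j, CoverFiltration (ι j) (V j)} {α : ℝ≥0}

theorem image_mk_mem_disjointUnion {j : J} {i : ι j} {ρ : Finset (V j)} :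
    ρ.image (Sigma.mk j) ∈ disjointUnion U ⟨j, i⟩ α ↔ ρ ∈ U j i α := by
  refine ⟨fun ⟨ρ', h, h'⟩ => ?_, fun h => ⟨ρ, h, rfl⟩⟩
  rwa [← Finset.image_injective sigma_mk_injective h']

/-- Cover elements that belong to different covers are disjoint. -/
theorem fst_eq_of_mem_disjointUnion {j : J} {x : Σ j, ι j} {ρ : Finset (V j)} (hρ : ρ.Nonempty)
    (h : ρ.image (Sigma.mk j) ∈ disjointUnion U x α) : x.1 = j := by
  obtain ⟨ρ', -, h'⟩ := h
  obtain ⟨v, hv⟩ := hρ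
  have : (⟨j, v⟩ : Σ j, V j) ∈ ρ'.image (Sigma.mk x.1) := by
    rw [show ρ'.image (Sigma.mk x.1) = _ from h']
    exact Finset.mem_image_of_mem _ hv
  obtain ⟨v', -, h⟩ := Finset.mem_image.mp this
  exact congrArg Sigma.fst h

theorem mem_union_disjointUnion {τ : Finset (Σ j, V j)} :
    τ ∈ (disjointUnion U).union α ↔ ∃ j, ∃ ρ ∈ (U j).union α, ρ.image (Sigma.mk j) = τ := by
  simp only [mem_union]
  exact ⟨fun ⟨⟨j, i⟩, ρ, h, h'⟩ => ⟨j, ρ, ⟨i, h⟩, h'⟩, fun ⟨j, ρ, ⟨i, h⟩, h'⟩ => ⟨⟨j, i⟩, ρ, h, h'⟩⟩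

theorem image_mk_mem_inter_disjointUnion {j : J} {v : Finset (Σ j, ι j)} {ρ : Finset (V j)} :
    ρ.image (Sigma.mk j) ∈ (disjointUnion U).inter v α ↔
      (∀ x ∈ v, x.1 = j) ∧
        ρ ∈ (U j).inter (v.preimage (Sigma.mk j) sigma_mk_injective.injOn) α := by
  simp only [mem_inter, Finset.mem_preimage, Finset.image_nonempty]
  refine ⟨fun ⟨h1, h2⟩ => ⟨fun x hx => fst_eq_of_mem_disjointUnion h1 (h2 x hx), h1,
    fun i hi => image_mk_mem_disjointUnion.mp (h2 _ hi)⟩, fun ⟨h1, h2, h3⟩ => ⟨h2, ?_⟩⟩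
  rintro ⟨j', i⟩ hx
  obtain rfl : j' = j := h1 _ hx
  exact image_mk_mem_disjointUnion.mpr (h3 i hx)

theorem exists_image_mk_of_mem_inter_disjointUnion {v : Finset (Σ j, ι j)} {j : J} {i : ι j}
    (hi : ⟨j, i⟩ ∈ v) {τ : Finset (Σ j, V j)} (hτ : τ ∈ (disjointUnion U).inter v α) :
    ∃ ρ : Finset (V j), ρ.image (Sigma.mk j) = τ := by
  obtain ⟨ρ, -, h⟩ := (mem_inter.mp hτ).2 _ hi
  exact ⟨ρ, h⟩

/-- Cover elements of different components do not intersect, so each simplex of the nerve lies in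
one component. -/
theorem mem_nerve_disjointUnion [DecidableEq (Σ j, ι j)] {v : Finset (Σ j, ι j)} :
    v ∈ (disjointUnion U).nerve α ↔ ∃ j, ∃ w ∈ (U j).nerve α, w.image (Sigma.mk j) = v := by
  simp only [mem_nerve]
  classical
  constructor
  · rintro ⟨⟨⟨j, i⟩, hi⟩, τ, hτ⟩
    obtain ⟨ρ, rfl⟩ := exists_image_mk_of_mem_inter_disjointUnion hi hτ
    obtain ⟨h1, h2⟩ := image_mk_mem_inter_disjointUnion.mp hτ
    refine ⟨j, _, ⟨⟨i, Finset.mem_preimage.mpr hi⟩, ρ, h2⟩, ?_⟩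
    rw [Finset.image_preimage, Finset.filter_true_of_mem]
    rintro ⟨j', i'⟩ hx
    obtain rfl : j' = j := h1 _ hx
    exact ⟨i', rfl⟩
  · rintro ⟨j, w, ⟨hw, ρ, hρ⟩, rfl⟩
    refine ⟨hw.image _, ρ.image (Sigma.mk j), image_mk_mem_inter_disjointUnion.mpr ⟨?_, ?_⟩⟩
    · intro x hx
      obtain ⟨i, -, rfl⟩ := Finset.mem_image.mp hx
      rfl
    · convert hρ
      ext i
      simp

theorem isCone_inter_disjointUnion [∀ j, DecidableEq (V j)]
    {v : Finset (Σ j, ι j)} {j : J} {i : ι j} (hi : ⟨j, i⟩ ∈ v) {w : Finset (ι j)}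
    (hw : ∀ i, i ∈ w ↔ ⟨j, i⟩ ∈ v) (h : IsCone ((U j).inter w α)) :
    IsCone ((disjointUnion U).inter v α) := by
  obtain rfl : w = v.preimage (Sigma.mk j) sigma_mk_injective.injOn := by
    ext i
    rw [hw, Finset.mem_preimage]
  obtain ⟨m, hm⟩ := h
  refine ⟨⟨j, m⟩, fun τ hτ => ?_⟩
  obtain ⟨ρ, rfl⟩ := exists_image_mk_of_mem_inter_disjointUnion hi hτ
  obtain ⟨h1, h2⟩ := image_mk_mem_inter_disjointUnion.mp hτ
  rw [← Finset.image_insert]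
  exact image_mk_mem_inter_disjointUnion.mpr ⟨h1, hm ρ h2⟩

end DisjointUnion

end CoverFiltration

theorem IsCone.reducedHomologyMap_eq_zero {V : Type*} [Fintype V] [DecidableEq V]
    {K L : PreAbstractSimplicialComplex V} (h : K ≤ L) (hKL : IsCone K ∨ IsCone L) (r : ℕ) :
    reducedHomologyMap h r = 0 := by
  rcases hKL with hK | hL
  · have := hK.subsingleton_reducedHomology r
    exact LinearMap.ext fun x => by rw [Subsingleton.elim x 0, map_zero, map_zero]
  · have := hL.subsingleton_reducedHomology r
    exact LinearMap.ext fun x => Subsingleton.elim _ _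

/-- A cone deformation retracts to its apex along straight lines. -/
theorem homotopicRel_const_of_insert_mem {V : Type*} [DecidableEq V]
    {K : PreAbstractSimplicialComplex V} {m : V}
    (hm : Pi.single m 1 ∈ geometricRealization K) (h : ∀ τ ∈ K, insert m τ ∈ K) :
    ContinuousMap.HomotopicRel (ContinuousMap.id (geometricRealization K))
      (ContinuousMap.const _ (⟨Pi.single m 1, hm⟩ : geometricRealization K))
      {⟨Pi.single m 1, hm⟩} := by
  have hmem : ∀ (t : unitInterval) (x : geometricRealization K),
      (1 - (t : ℝ)) • (x : V → ℝ) + (t : ℝ) • (Pi.single m 1 : V → ℝ) ∈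
        geometricRealization K := by
    intro t x
    obtain ⟨τ, hτ, hx⟩ := Set.mem_iUnion₂.mp x.2
    refine Set.mem_iUnion₂.mpr ⟨insert m τ, h τ hτ, ?_⟩
    refine convex_convexHull ℝ _ (convexHull_mono (Set.image_mono ?_) hx)
      (subset_convexHull ℝ _ ⟨m, by simp, rfl⟩) (by linarith [t.2.2]) t.2.1 (by ring)
    exact Finset.coe_subset.mpr (Finset.subset_insert _ _)
  refine ⟨{ toFun := fun p => ⟨_, hmem p.1 p.2⟩
            continuous_toFun := by fun_prop
            map_zero_left := fun x => by ext; simp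
            map_one_left := fun x => by ext; simp
            prop' := ?_ }⟩
  rintro t x hx
  obtain rfl := Set.mem_singleton_iff.mp hx
  ext v
  simp [sub_mul]

end Cover

/-! ### The cover by growing facets -/

section FacetCover

variable {n : ℕ} {α : ℝ≥0}

/-- All three stages of the growing facets at once: for `α < n + 1` the last two alternatives are
impossible, and for `2 * n + 2 ≤ α` the last one holds. -/
theorem mem_facetCover {i : Fin (n + 2)} {τ : Finset (Fin (n + 2))} :
    τ ∈ facetCover n i α ↔ τ.Nonempty ∧ (i ∉ τ ∨
      (∃ k : Fin (n + 2), (k : ℕ) + (n + 1) ≤ ⌊α⌋₊ ∧ k ∉ τ) ∨ 2 * n + 2 ≤ ⌊α⌋₊) := by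
  have hfacet : ∀ k : Fin (n + 2), τ ∈ simplexFacet n k ↔ τ.Nonempty ∧ k ∉ τ := fun k =>
    and_congr_right fun _ => Set.subset_compl_singleton_iff
  have hsup : ∀ K L : PreAbstractSimplicialComplex (Fin (n + 2)),
      τ ∈ K ⊔ L ↔ τ ∈ K ∨ τ ∈ L := fun _ _ => Iff.rfl
  have h1 : α < n + 1 ↔ ⌊α⌋₊ < n + 1 := by
    rw [Nat.floor_lt (zero_le)]; push_cast; rfl
  have h2 : α < 2 * n + 2 ↔ ⌊α⌋₊ < 2 * n + 2 := by
    rw [Nat.floor_lt (zero_le)]; push_cast; rfl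
  change τ ∈ growingFacetComplex n i α ↔ _
  unfold growingFacetComplex
  simp only [h1, h2]
  split_ifs with h h'
  · rw [hfacet]
    refine and_congr_right fun _ => ⟨Or.inl, ?_⟩
    rintro (h3 | ⟨k, hk, -⟩ | h3)
    · exact h3
    · omega
    · omega
  · simp only [hsup, hfacet, mem_iSup_complex, Subtype.exists, exists_prop]
    constructor
    · rintro (⟨h3, h4⟩ | ⟨k, hk, h3, h4⟩)
      · exact ⟨h3, Or.inl h4⟩
      · exact ⟨h3, Or.inr (Or.inl ⟨k, hk, h4⟩)⟩
    · rintro ⟨h3, h4 | ⟨k, hk, h4⟩ | h4⟩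
      · exact Or.inl ⟨h3, h4⟩
      · exact Or.inr ⟨k, hk, h3, h4⟩
      · exact absurd h4 (not_le.mpr h')
  · exact ⟨fun h => ⟨h.1, Or.inr (Or.inr (not_lt.mp h'))⟩, fun h => ⟨h.1, Set.subset_univ _⟩⟩

theorem mem_inter_facetCover {σ τ : Finset (Fin (n + 2))} :
    τ ∈ (facetCover n).inter σ α ↔ τ.Nonempty ∧ (Disjoint σ τ ∨
      (∃ k : Fin (n + 2), (k : ℕ) + (n + 1) ≤ ⌊α⌋₊ ∧ k ∉ τ) ∨ 2 * n + 2 ≤ ⌊α⌋₊) := by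
  simp only [CoverFiltration.mem_inter, mem_facetCover, Finset.disjoint_left]
  grind

theorem mem_union_facetCover {τ : Finset (Fin (n + 2))} :
    τ ∈ (facetCover n).union α ↔ τ.Nonempty ∧ (τ ≠ Finset.univ ∨ 2 * n + 2 ≤ α) := by
  have h2 : 2 * n + 2 ≤ α ↔ 2 * n + 2 ≤ ⌊α⌋₊ := by
    rw [Nat.le_floor_iff (zero_le)]; push_cast; rfl
  simp only [CoverFiltration.mem_union, mem_facetCover, h2, ne_eq, Finset.eq_univ_iff_forall,
    not_forall]
  constructor
  · rintro ⟨i, h, h1 | ⟨k, -, h1⟩ | h1⟩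
    · exact ⟨h, Or.inl ⟨i, h1⟩⟩
    · exact ⟨h, Or.inl ⟨k, h1⟩⟩
    · exact ⟨h, Or.inr h1⟩
  · rintro ⟨h, ⟨i, h1⟩ | h1⟩
    · exact ⟨i, h, Or.inl h1⟩
    · exact ⟨0, h, Or.inr (Or.inr h1)⟩

theorem mem_nerve_facetCover {σ : Finset (Fin (n + 2))} :
    σ ∈ (facetCover n).nerve α ↔ σ.Nonempty ∧ (σ ≠ Finset.univ ∨ n + 1 ≤ α) := by
  have h1 : n + 1 ≤ α ↔ n + 1 ≤ ⌊α⌋₊ := by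
    rw [Nat.le_floor_iff (zero_le)]; push_cast; rfl
  simp only [CoverFiltration.mem_nerve, mem_inter_facetCover, h1]
  refine and_congr_right fun _ => ⟨?_, ?_⟩
  · rintro ⟨τ, ⟨v, hv⟩, h | ⟨k, hk, -⟩ | h⟩
    · exact Or.inl fun h' => Finset.disjoint_left.mp h (h' ▸ Finset.mem_univ v) hv
    · exact Or.inr (by omega)
    · exact Or.inr (by omega)
  · rintro (h | h)
    · rw [ne_eq, Finset.eq_univ_iff_forall, not_forall] at h
      obtain ⟨i, hi⟩ := h
      exact ⟨{i}, Finset.singleton_nonempty i, Or.inl (Finset.disjoint_singleton_right.mpr hi)⟩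
    · -- the last vertex lies in the facet opposite to `0`, which is now part of all cover elements
      refine ⟨{Fin.last _}, Finset.singleton_nonempty _, Or.inr (Or.inl ⟨0, by simpa using h, ?_⟩)⟩
      rw [Finset.mem_singleton]
      exact (Fin.last_pos).ne

theorem insert_mem_inter_facetCover {σ τ : Finset (Fin (n + 2))} {m : Fin (n + 2)} (hmσ : m ∉ σ)
    (hm : ⌊α⌋₊ < (m : ℕ) + (n + 1)) (hτ : τ ∈ (facetCover n).inter σ α) :
    insert m τ ∈ (facetCover n).inter σ α := by
  rw [mem_inter_facetCover] at hτ ⊢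
  obtain ⟨h1, h2⟩ := hτ
  refine ⟨Finset.insert_nonempty _ _, h2.imp (fun h => ?_) (Or.imp_left ?_)⟩
  · exact Finset.disjoint_insert_right.mpr ⟨hmσ, h⟩
  · rintro ⟨k, hk, hkτ⟩
    refine ⟨k, hk, fun h => (Finset.mem_insert.mp h).elim (fun h => ?_) hkτ⟩
    rw [h] at hk
    omega

/-- If one of the facets that are already contained in all cover elements has its index `p` in `σ`,
then the intersection is a cone whose apex is the last vertex. -/
theorem isCone_inter_facetCover_of_mem {σ : Finset (Fin (n + 2))} {p : Fin (n + 2)} (hpσ : p ∈ σ)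
    (hp : (p : ℕ) + (n + 1) ≤ ⌊α⌋₊) : IsCone ((facetCover n).inter σ α) := by
  refine ⟨Fin.last _, fun τ hτ => ?_⟩
  rw [mem_inter_facetCover] at hτ ⊢
  refine ⟨Finset.insert_nonempty _ _, Or.inr ?_⟩
  by_cases hα : 2 * n + 2 ≤ ⌊α⌋₊
  · exact Or.inr hα
  have : ∃ k : Fin (n + 2), (k : ℕ) + (n + 1) ≤ ⌊α⌋₊ ∧ k ∉ τ := by
    rcases hτ.2 with h | h | h
    · exact ⟨p, hp, Finset.disjoint_left.mp h hpσ⟩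
    · exact h
    · exact absurd h hα
  obtain ⟨k, hk, hkτ⟩ := this
  refine Or.inl ⟨k, hk, fun h => (Finset.mem_insert.mp h).elim (fun h => ?_) hkτ⟩
  rw [h, Fin.val_last] at hk
  omega

/-- Intersections of growing facets are cones with one exception: for `⌊α⌋ = n + 1 + j` with
`j ≤ n`, the intersection over `σ = {j + 1, …, n + 1}`. -/
theorem isCone_inter_facetCover {σ : Finset (Fin (n + 2))}
    (h : (∃ m, (m ∈ σ ↔ (m : ℕ) + (n + 1) ≤ ⌊α⌋₊)) ∨ ⌊α⌋₊ < n + 1 ∨ 2 * n + 2 ≤ ⌊α⌋₊) :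
    IsCone ((facetCover n).inter σ α) := by
  by_cases h1 : ∃ m, (m ∈ σ ↔ (m : ℕ) + (n + 1) ≤ ⌊α⌋₊)
  · obtain ⟨m, hm⟩ := h1
    by_cases hmσ : m ∈ σ
    · exact isCone_inter_facetCover_of_mem hmσ (hm.mp hmσ)
    · exact ⟨m, fun τ => insert_mem_inter_facetCover hmσ (not_le.mp (mt hm.mpr hmσ))⟩
  · refine ⟨0, fun τ hτ => ?_⟩
    rw [mem_inter_facetCover] at hτ ⊢
    refine ⟨Finset.insert_nonempty _ _, ?_⟩
    rcases h.resolve_left h1 with h2 | h2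
    · -- here `σ` consists of all vertices, and the intersection is empty
      exfalso
      obtain ⟨⟨v, hv⟩, h | ⟨k, hk, -⟩ | h⟩ := hτ
      · refine h1 ⟨v, iff_of_false (fun hvσ => Finset.disjoint_left.mp h hvσ hv) (by omega)⟩
      · omega
      · omega
    · exact Or.inr (Or.inr h2)

/-- The exceptional intersections become cones within one unit of scale. -/
theorem isCone_inter_facetCover_or_add_one (σ : Finset (Fin (n + 2))) (α : ℝ≥0) :
    IsCone ((facetCover n).inter σ α) ∨ IsCone ((facetCover n).inter σ (α + 1)) := by
  by_contra! h
  have h1 := mt isCone_inter_facetCover h.1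
  have h2 := mt isCone_inter_facetCover h.2
  rw [Nat.floor_add_one zero_le] at h2
  push Not at h1 h2
  have h3 := h1.1 ⟨⌊α⌋₊ - n, by omega⟩
  have h4 := h2.1 ⟨⌊α⌋₊ - n, by omega⟩
  by_cases hm : (⟨⌊α⌋₊ - n, by omega⟩ : Fin (n + 2)) ∈ σ <;> simp [hm] at h3 h4 <;> omega

theorem isGood_facetCover (n : ℕ) : (facetCover n).IsGood 1 := fun σ _ α r =>
  IsCone.reducedHomologyMap_eq_zero _ (isCone_inter_facetCover_or_add_one σ α) r

theorem isGood_facetCoverUnion (N : ℕ) {ε : ℝ≥0} (hε : 0 < ε) : (facetCoverUnion N ε).IsGood ε := by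
  rintro v ⟨⟨j, i⟩, hi⟩ α r
  refine IsCone.reducedHomologyMap_eq_zero _ ?_ r
  have key : ∀ β : ℝ≥0, IsCone ((facetCover j).inter
      (Finset.univ.filter fun i => (⟨j, i⟩ : Σ n : Fin (N + 1), Fin ((n : ℕ) + 2)) ∈ v) (β / ε)) →
      IsCone ((facetCoverUnion N ε).inter v β) := fun β h =>
    CoverFiltration.isCone_inter_disjointUnion
      (U := fun j : Fin (N + 1) => (facetCover j).rescale ε) hi (by simp)
      ((CoverFiltration.inter_rescale _ _ _ _).symm ▸ h)
  -- a step of `ε` is a step of one unit on the original scale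
  have hα : α / ε + 1 = (α + ε) / ε := by rw [add_div, div_self hε.ne']
  refine (isCone_inter_facetCover_or_add_one _ (α / ε)).imp (key α) fun h => key (α + ε) ?_
  rwa [← hα]

theorem card_fiberFinset_unit (j : Unit) :
    (fiberFinset (fun _ : Fin (n + 2) => ()) j).card = n + 2 := by
  simp [fiberFinset]

theorem mem_sphereUnion_unit {S : Set Unit} {τ : Finset (Fin (n + 2))} :
    τ ∈ sphereUnion (fun _ => ()) S ↔ τ.Nonempty ∧ (τ ≠ Finset.univ ∨ () ∈ S) := by
  have : fiberFinset (fun _ : Fin (n + 2) => ()) () = Finset.univ := by simp [fiberFinset]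
  rw [mem_sphereUnion]
  refine and_congr_right fun _ => ⟨fun ⟨_, _, h⟩ => this ▸ h, fun h => ⟨(), ?_, this ▸ h⟩⟩
  exact this ▸ Finset.subset_univ τ

theorem union_facetCover (n : ℕ) : (facetCover n).union =
    sphereFiltration (fun _ => ()) fun _ => (2 * n + 2 : ℝ≥0) := by
  refine OrderHom.ext _ _ (funext fun α => SetLike.ext fun τ => ?_)
  exact mem_union_facetCover.trans (mem_sphereUnion_unit (S := {_j | _})).symm

theorem nerve_facetCover (n : ℕ) : (facetCover n).nerve =
    sphereFiltration (fun _ => ()) fun _ => (n + 1 : ℝ≥0) := by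
  refine OrderHom.ext _ _ (funext fun α => SetLike.ext fun τ => ?_)
  exact mem_nerve_facetCover.trans (mem_sphereUnion_unit (S := {_j | _})).symm

section Sigma

variable {J : Type*} [DecidableEq J] [Fintype J] {V : J → Type*} [∀ j, Fintype (V j)]
  [∀ j, DecidableEq (V j)]

theorem fiberFinset_sigma_fst (j : J) : fiberFinset (Sigma.fst : (Σ j, V j) → J) j =
    Finset.univ.image (Sigma.mk j) := by
  ext ⟨i, v⟩
  simp only [mem_fiberFinset, Finset.mem_image, Finset.mem_univ, true_and]
  exact ⟨fun h => by subst h; exact ⟨v, rfl⟩, fun ⟨v', h⟩ => (congrArg Sigma.fst h).symm⟩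

theorem card_fiberFinset_sigma_fst (j : J) :
    (fiberFinset (Sigma.fst : (Σ j, V j) → J) j).card = Fintype.card (V j) := by
  rw [fiberFinset_sigma_fst, Finset.card_image_of_injective _ sigma_mk_injective, Finset.card_univ]

theorem mem_sphereUnion_sigma_fst {S : Set J} {τ : Finset (Σ j, V j)} :
    τ ∈ sphereUnion Sigma.fst S ↔ ∃ j, ∃ ρ : Finset (V j),
      (ρ.Nonempty ∧ (ρ ≠ Finset.univ ∨ j ∈ S)) ∧ ρ.image (Sigma.mk j) = τ := by
  simp only [mem_sphereUnion, fiberFinset_sigma_fst]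
  constructor
  · rintro ⟨h1, j, h2, h3⟩
    obtain ⟨ρ, -, rfl⟩ := Finset.subset_image_iff.mp h2
    exact ⟨j, ρ, ⟨Finset.image_nonempty.mp h1, h3.imp_left fun h h' => h (h' ▸ rfl)⟩, rfl⟩
  · rintro ⟨j, ρ, ⟨h1, h2⟩, rfl⟩
    exact ⟨h1.image _, j, Finset.image_subset_image (Finset.subset_univ _),
      h2.imp_left fun h h' => h (Finset.image_injective sigma_mk_injective h')⟩

end Sigma

theorem union_facetCoverUnion (N : ℕ) {ε : ℝ≥0} (hε : 0 < ε) : (facetCoverUnion N ε).union =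
    sphereFiltration (Sigma.fst : (Σ j : Fin (N + 1), Fin ((j : ℕ) + 2)) → _) fun j =>
      (2 * (j : ℕ) + 2 : ℝ≥0) * ε := by
  refine OrderHom.ext _ _ (funext fun α => SetLike.ext fun τ => ?_)
  refine CoverFiltration.mem_union_disjointUnion.trans
    (Iff.trans ?_ (mem_sphereUnion_sigma_fst (S := {_j | _})).symm)
  refine exists_congr fun j => exists_congr fun ρ => and_congr_left fun _ => ?_
  refine mem_union_facetCover.trans ?_
  rw [Set.mem_ofPred_eq, le_div_iff₀ hε]

theorem nerve_facetCoverUnion (N : ℕ) {ε : ℝ≥0} (hε : 0 < ε) : (facetCoverUnion N ε).nerve =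
    sphereFiltration (Sigma.fst : (Σ j : Fin (N + 1), Fin ((j : ℕ) + 2)) → _) fun j =>
      ((j : ℕ) + 1 : ℝ≥0) * ε := by
  refine OrderHom.ext _ _ (funext fun α => SetLike.ext fun τ => ?_)
  refine CoverFiltration.mem_nerve_disjointUnion.trans
    (Iff.trans ?_ (mem_sphereUnion_sigma_fst (S := {_j | _})).symm)
  refine exists_congr fun j => exists_congr fun ρ => and_congr_left fun _ => ?_
  refine mem_nerve_facetCover.trans ?_
  rw [Set.mem_ofPred_eq, le_div_iff₀ hε]

theorem Dgm_sphereFiltration_unit (T : ℝ≥0) (r : ℕ) {x : ℝ} {y : EReal} (hxy : (x : EReal) < y) :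
    Dgm r (sphereFiltration (fun _ : Fin (n + 2) => ()) fun _ => T) (x, y) =
      (if r = n ∧ x = 0 ∧ y = ((T : ℝ) : EReal) then 1 else 0) +
        (if r = 0 ∧ x = 0 ∧ y = ⊤ then 1 else 0) := by
  rw [Dgm_sphereFiltration (fun _ => ⟨0, rfl⟩) (d := fun _ => n) card_fiberFinset_unit r hxy]
  by_cases hx : x = 0
  · by_cases hy : y = ⊤
    · simp [hx, hy, (EReal.coe_ne_top (T : ℝ)).symm]
    · simp only [hx, hy, if_true, if_false, Finset.univ_unique, Finset.filter_singleton,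
        apply_ite Finset.card, Finset.card_singleton, Finset.card_empty, true_and, and_false,
        add_zero, Nat.cast_ite, Nat.cast_one, Nat.cast_zero, eq_comm (a := y), eq_comm (a := r)]
  · simp [hx]

end FacetCover

end

theorem mainTheorem4 :
    (∀ n : ℕ,
      -- the homology of the union filtration and of the nerve filtration
      (∀ (α : ℝ≥0) (r : ℕ),
        Module.finrank (ZMod 2) (ReducedHomology ((facetCover n).union α) r) =
          if r = n ∧ α < 2 * n + 2 then 1 else 0) ∧
      (∀ (α : ℝ≥0) (r : ℕ),
        Module.finrank (ZMod 2) (ReducedHomology ((facetCover n).nerve α) r) =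
          if r = n ∧ α < n + 1 then 1 else 0) ∧
      -- their persistence diagrams above the diagonal
      (∀ (r : ℕ) (x : ℝ) (y : EReal), (x : EReal) < y →
        Dgm r (facetCover n).union (x, y) =
          (if r = n ∧ x = 0 ∧ y = ((2 * n + 2 : ℝ) : EReal) then 1 else 0) +
            (if r = 0 ∧ x = 0 ∧ y = ⊤ then 1 else 0)) ∧
      (∀ (r : ℕ) (x : ℝ) (y : EReal), (x : EReal) < y →
        Dgm r (facetCover n).nerve (x, y) =
          (if r = n ∧ x = 0 ∧ y = ((n + 1 : ℝ) : EReal) then 1 else 0) +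
            (if r = 0 ∧ x = 0 ∧ y = ⊤ then 1 else 0)) ∧
      -- the bottleneck distance
      bottleneckDist (Dgm n (facetCover n).nerve) (Dgm n (facetCover n).union) = n + 1 ∧
      -- the intersections of the cover elements at the scales `n + 1 + j`, for `0 ≤ j ≤ n`
      (∀ j : Fin (n + 2), (j : ℕ) ≤ n →
        (∀ (σ : Finset (Fin (n + 2))) (m : Fin (n + 2)), σ.Nonempty → j < m → m ∉ σ →
          (∃ hm : Pi.single m 1 ∈ geometricRealization
              ((facetCover n).inter σ ((n + 1 + (j : ℕ) : ℕ) : ℝ≥0)),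
            ContinuousMap.HomotopicRel (ContinuousMap.id _)
              (ContinuousMap.const _ (⟨Pi.single m 1, hm⟩ : geometricRealization
                ((facetCover n).inter σ ((n + 1 + (j : ℕ) : ℕ) : ℝ≥0))))
              {⟨Pi.single m 1, hm⟩}) ∧
          ∀ r : ℕ, Subsingleton (ReducedHomology
            ((facetCover n).inter σ ((n + 1 + (j : ℕ) : ℕ) : ℝ≥0)) r)) ∧
        (∀ p : Fin (n + 2), p ≤ j → ∀ r : ℕ, Subsingleton (ReducedHomology
          ((facetCover n).inter (insert p (Finset.Ioi j)) ((n + 1 + (j : ℕ) : ℕ) : ℝ≥0)) r)) ∧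
        (∀ σ : Finset (Fin (n + 2)), Finset.Ioi j ⊆ σ → 2 ≤ (σ ∩ Finset.Iic j).card →
          ∀ r : ℕ, Subsingleton (ReducedHomology
            ((facetCover n).inter σ ((n + 1 + (j : ℕ) : ℕ) : ℝ≥0)) r)) ∧
        (∀ σ : Finset (Fin (n + 2)), σ.Nonempty →
          (∃ r : ℕ, Nontrivial (ReducedHomology
            ((facetCover n).inter σ ((n + 1 + (j : ℕ) : ℕ) : ℝ≥0)) r)) → σ = Finset.Ioi j)) ∧
      -- the cover filtration is `1`-good
      (facetCover n).IsGood 1) ∧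
    -- the bound `(K + 1) ε` is attained in all dimensions `K ≤ N` by a single `ε`-good cover
    (∀ (N : ℕ) (ε : ℝ≥0), 0 < ε →
      (facetCoverUnion N ε).IsGood ε ∧
      ∀ K : ℕ, K ≤ N →
        bottleneckDist (Dgm K (facetCoverUnion N ε).nerve) (Dgm K (facetCoverUnion N ε).union) =
          (K + 1) * (ε : ℝ≥0∞)) :=
 by
  refine ⟨fun n => ⟨fun α r => ?_, fun α r => ?_, fun r x y hxy => ?_, fun r x y hxy => ?_, ?_,
    fun j hj => ?_, isGood_facetCover n⟩, fun N ε hε => ⟨isGood_facetCoverUnion N hε,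
    fun K hK => ?_⟩⟩
  · rw [union_facetCover]
    refine (finrank_reducedHomology_sphereUnion (fun _ => ⟨0, rfl⟩) (d := fun _ => n)
      card_fiberFinset_unit r).trans ?_
    simp only [Set.mem_ofPred_eq, not_le]
  · rw [nerve_facetCover]
    refine (finrank_reducedHomology_sphereUnion (fun _ => ⟨0, rfl⟩) (d := fun _ => n)
      card_fiberFinset_unit r).trans ?_
    simp only [Set.mem_ofPred_eq, not_le]
  · rw [union_facetCover, Dgm_sphereFiltration_unit _ _ hxy]
    push_cast
    rfl
  · rw [nerve_facetCover, Dgm_sphereFiltration_unit _ _ hxy]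
    push_cast
    rfl
  · rw [union_facetCover, nerve_facetCover]
    refine (bottleneckDist_sphereFiltration (fun _ => ⟨0, rfl⟩) (d := fun _ => n) (j := ())
      card_fiberFinset_unit (fun _ => by simp) (t := n + 1) (by positivity) rfl (by ring)).trans ?_
    push_cast
    rfl
  · have hfloor : ⌊((n + 1 + (j : ℕ) : ℕ) : ℝ≥0)⌋₊ = n + 1 + j := Nat.floor_natCast _
    refine ⟨fun σ m hσ hm hmσ => ?_, fun p hp r => ?_, fun σ hσ hcard r => ?_,
      fun σ hσ ⟨r, hr⟩ => ?_⟩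
    · have hm : (j : ℕ) < m := hm
      have hins : ∀ τ ∈ (facetCover n).inter σ ((n + 1 + (j : ℕ) : ℕ) : ℝ≥0),
          insert m τ ∈ (facetCover n).inter σ ((n + 1 + (j : ℕ) : ℕ) : ℝ≥0) :=
        fun τ => insert_mem_inter_facetCover hmσ (by omega)
      have hvertex : {m} ∈ (facetCover n).inter σ ((n + 1 + (j : ℕ) : ℕ) : ℝ≥0) :=
        mem_inter_facetCover.mpr
          ⟨Finset.singleton_nonempty m, Or.inl (Finset.disjoint_singleton_right.mpr hmσ)⟩
      have hreal : Pi.single m 1 ∈ geometricRealization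
          ((facetCover n).inter σ ((n + 1 + (j : ℕ) : ℕ) : ℝ≥0)) :=
        Set.mem_iUnion₂.mpr ⟨{m}, hvertex, subset_convexHull ℝ _ ⟨m, by simp, rfl⟩⟩
      exact ⟨⟨hreal, homotopicRel_const_of_insert_mem hreal hins⟩,
        IsCone.subsingleton_reducedHomology ⟨m, hins⟩⟩
    · have hp : (p : ℕ) ≤ j := hp
      exact (isCone_inter_facetCover_of_mem (Finset.mem_insert_self p _)
        (by omega)).subsingleton_reducedHomology r
    · obtain ⟨p, hp⟩ := Finset.card_pos.mp (by omega : 0 < (σ ∩ Finset.Iic j).card)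
      obtain ⟨hpσ, hpj⟩ := Finset.mem_inter.mp hp
      have hpj : p ≤ j := Finset.mem_Iic.mp hpj
      have hpj : (p : ℕ) ≤ j := hpj
      exact (isCone_inter_facetCover_of_mem hpσ (by omega)).subsingleton_reducedHomology r
    · by_contra hne
      refine not_subsingleton_iff_nontrivial.mpr hr
        (IsCone.subsingleton_reducedHomology (isCone_inter_facetCover (Or.inl ?_)) r)
      by_contra! h
      refine hne (Finset.ext fun m => ?_)
      have hm := h m
      rw [Finset.mem_Ioi, Fin.lt_def]
      by_cases hmσ : m ∈ σ <;> simp only [hmσ, true_iff, false_iff] at hm ⊢ <;> grind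
  · rw [union_facetCoverUnion N hε, nerve_facetCoverUnion N hε]
    refine (bottleneckDist_sphereFiltration (J := Fin (N + 1)) (j := ⟨K, Nat.lt_succ_of_le hK⟩)
      (π := (Sigma.fst : (Σ j : Fin (N + 1), Fin ((j : ℕ) + 2)) → _)) (d := Fin.val)
      (t := (K + 1) * ε) (fun j => ⟨⟨j, 0⟩, rfl⟩)
      (fun j => (card_fiberFinset_sigma_fst j).trans (Fintype.card_fin _))
      (fun i => by simp [Fin.ext_iff]) (by positivity) rfl (by ring)).trans ?_
    push_cast
    rfl
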